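/- **Theorem (Equivalent MDP).** *Model.* Fix integers $\hat\Delta\ge 1$ (age cap), $P\ge 1$ (contact period), $0\le W\le P$ (visible-window length), $C_S\ge 1$, $U_{\mathrm{tx}}\ge 1$, $U_{\mathrm{img}},C_L\ge 0$ with $U_{\mathrm{img}}+C_L\ge 1$, and probabilities $p_T,p_O\in[0,1]$. The finite state space $\mathcal S$ consists of all $s=(\Delta,\phi,q,\tau)$ with $\Delta\in\{1,\dots,\hat\Delta\}$ (ground Age of Inference, AoInf), $\phi\in\{0,\dots,P-1\}$ (contact phase), $q\in\{0,1\}$ (cache occupancy), $\tau\in\{0,\dots,\hat\Delta\}$ (cache age) and $\tau=0$ if $q=0$. Put $r(\phi)=W-\phi$ if $\phi<W$ and $r(\phi)=0$ otherwise. The actions are idle, compute, tx and offload, with durations in slots $L_{\mathrm{idle}}=1$, $L_{\mathrm{compute}}=C_S$, $L_{\mathrm{tx}}=U_{\mathrm{tx}}$, $L_{\mathrm{offload}}=U_{\mathrm{img}}+C_L$. Idle and compute are always admissible, tx is admissible iff $q=1$ and $r(\phi)\ge U_{\mathrm{tx}}$, and offload is admissible iff $r(\phi)\ge U_{\mathrm{img}}$.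 After action $a$ in state $s$, the phase becomes $(\phi+L_a)\bmod P$. The pair $(q,\tau)$ becomes $(q,\,q\min\{\tau+L_a,\hat\Delta\})$ for idle and offload, $(1,\min\{L_a,\hat\Delta\})$ for compute, and $(0,0)$ for tx. With probability $1-p_a$ the new AoInf is $\min\{\Delta+L_a,\hat\Delta\}$, and with probability $p_a$ it is $\min\{\tau+L_a,\hat\Delta\}$ for tx and $\min\{L_a,\hat\Delta\}$ for offload; here $p_{\mathrm{idle}}=p_{\mathrm{compute}}=0$, $p_{\mathrm{tx}}=p_T$, $p_{\mathrm{offload}}=p_O$. Let $P(s'\mid s,a)$ be the resulting transition probability. In the $i$-th slot ($0\le i<L_a$) of an action started with AoInf $\Delta$, the AoInf is $\min\{\Delta+i,\hat\Delta\}$; let $R(s,a)=\sum_{i=0}^{L_a-1}\min\{\Delta+i,\hat\Delta\}$. Policies are randomized and history-dependent, choosing admissible actions at decision epochs; a (possibly randomized) policy is stationary if its choice depends on the current state only. The average cost of a policy $\pi$ from the initial state $s$ in this semi-Markov decision process (SMDP) is $$J(\pi,s)=\limsup_{N\to\infty}\frac1N\,\mathbb E_\pi^s\Big[\sum_{n=1}^{N}\Delta_G(n)\Big],$$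 where $\Delta_G(n)$ is the AoInf in slot $n$, slot $1$ being the first slot of the first action. *Transformed MDP.* Let $\theta\in(0,\min_a L_a]$. Consider the discrete-time MDP with the same states and admissible actions, one-step cost $\bar R_\theta(s,a)=\theta R(s,a)/L_a$ and transition kernel $$\bar P_\theta(s'\mid s,a)=\begin{cases}\frac{\theta}{L_a}P(s'\mid s,a), & s'\ne s,\\[2pt] 1-\frac{\theta}{L_a}+\frac{\theta}{L_a}P(s\mid s,a), & s'=s,\end{cases}$$ and let $\bar J_\theta(\pi,s)=\limsup_{N\to\infty}\frac1N\,\bar{\mathbb E}_\pi^s\big[\sum_{k=0}^{N-1}\bar R_\theta(s_k,a_k)\big]$ be its average cost. *Conclusion.* 1. The transformed MDP has the same stationary optimal policies as the SMDP: for every initial state $s$, a stationary policy minimizes $J(\cdot,s)$ over all policies if and only if it minimizes $\bar J_\theta(\cdot,s)$ over all policies (hence the stationary policies that are optimal from all initial states also agree). 2. There is a constant $\rho^\star$ such that, for every initial state $s$, $\min_\pi J(\pi,s)=\rho^\star$ and $\min_\pi \bar J_\theta(\pi,s)=\theta\rho^\star$, both minima being attained. That is, if $\rho^\star$ is the optimal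 average AoInf of the SMDP, then the optimal average cost of the transformed MDP is $\theta\rho^\star$. -/

import Mathlib

open scoped BigOperators Classical
open Filter

/-! ## Controlled finite-state processes -/

/-- A randomized history-dependent policy with admissible state-action pairs `feas`. The history `h`
lists the pairs (state, action) of all earlier decision epochs; `prob h s a` is the probability of
choosing `a` in the current state `s` after the history `h`. -/
structure Policy {S A : Type} [Fintype A] (feas : S → A → Prop) where
  prob : List (S × A) → S → A → ℝ
  nonneg : ∀ h s a, 0 ≤ prob h s a
  sum_one : ∀ h s, ∑ a, prob h s a = 1
  support : ∀ h s a, ¬ feas s a → prob h s a = 0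

/-- A (randomized) stationary policy: the choice depends on the current state only. The
deterministic stationary policies are those with values in `{0, 1}`. -/
structure StationaryPolicy {S A : Type} [Fintype A] (feas : S → A → Prop) where
  prob : S → A → ℝ
  nonneg : ∀ s a, 0 ≤ prob s a
  sum_one : ∀ s, ∑ a, prob s a = 1
  support : ∀ s a, ¬ feas s a → prob s a = 0

/-- A stationary policy, seen as a history-dependent policy. -/
def StationaryPolicy.toPolicy {S A : Type} [Fintype A] {feas : S → A → Prop}
    (σ : StationaryPolicy feas) : Policy feas where
  prob := fun _ s a => σ.prob s a
  nonneg := fun _ s a => σ.nonneg s a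
  sum_one := fun _ s => σ.sum_one s
  support := fun _ s a => σ.support s a

/-- Probability that, after the history `h`, with the next state distributed as `μ`, the next
decision epochs produce exactly the listed pairs (state, action), under the transition law `K`. -/
noncomputable def pathProb {S A : Type} [Fintype A] {feas : S → A → Prop}
    (K : S → A → S → ℝ) (π : Policy feas) :
    List (S × A) → (S → ℝ) → List (S × A) → ℝ
  | _, _, [] => 1
  | h, μ, (s, a) :: l => μ s * π.prob h s a * pathProb K π (h ++ [(s, a)]) (K s a) l

/-- Expectation, under the policy `π` started in `s₀`, of a function `f` of the first `n` pairs
(state, action). -/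
noncomputable def pathExpect {S A : Type} [Fintype S] [Fintype A] {feas : S → A → Prop}
    (K : S → A → S → ℝ) (π : Policy feas) (s₀ : S) (n : ℕ) (f : List (S × A) → ℝ) : ℝ :=
  ∑ ω : Fin n → S × A,
    pathProb K π [] (fun s => if s = s₀ then 1 else 0) (List.ofFn ω) * f (List.ofFn ω)

/-! ## The Age-of-Inference model -/

/-- The four candidate actions. -/
inductive AoAction where
  | idle
  | compute
  | tx
  | offload
  deriving DecidableEq

instance : Fintype AoAction where
  elems := {AoAction.idle, AoAction.compute, AoAction.tx, AoAction.offload}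
  complete := by intro a; cases a <;> simp

/-- Parameters: age cap `cap`, contact period `period`, visible-window length `window`, compute
time `CS`, semantic transmission time `Utx`, raw upload time `Uimg`, ground inference time `CL`,
and success probabilities `pT` (semantic transmission) and `pO` (offloading). -/
structure AoInfModel where
  cap : ℕ
  period : ℕ
  window : ℕ
  CS : ℕ
  Utx : ℕ
  Uimg : ℕ
  CL : ℕ
  pT : ℝ
  pO : ℝ
  cap_pos : 0 < cap
  period_pos : 0 < period
  window_le : window ≤ period
  CS_pos : 0 < CS
  Utx_pos : 0 < Utx
  offload_pos : 0 < Uimg + CL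
  pT_nonneg : 0 ≤ pT
  pT_le_one : pT ≤ 1
  pO_nonneg : 0 ≤ pO
  pO_le_one : pO ≤ 1

namespace AoInfModel

/-- The admissible states: ground age `age` in `{1, …, cap}`, contact phase in
`{0, …, period - 1}`, cache occupancy, cache age in `{0, …, cap}`, which is `0` if the cache is
empty. -/
@[ext]
structure State (M : AoInfModel) where
  age : ℕ
  phase : ℕ
  cached : Bool
  cacheAge : ℕ
  age_pos : 1 ≤ age
  age_le : age ≤ M.cap
  phase_lt : phase < M.period
  cacheAge_le : cacheAge ≤ M.cap
  cacheAge_empty : cached = false → cacheAge = 0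

noncomputable instance (M : AoInfModel) : Fintype M.State :=
  Fintype.ofInjective
    (fun s : M.State =>
      ((⟨s.age, Nat.lt_succ_of_le s.age_le⟩, ⟨s.phase, s.phase_lt⟩, s.cached,
        ⟨s.cacheAge, Nat.lt_succ_of_le s.cacheAge_le⟩) :
        Fin (M.cap + 1) × Fin M.period × Bool × Fin (M.cap + 1)))
    (by
      intro s t h
      simp only [Prod.mk.injEq, Fin.mk.injEq] at h
      exact State.ext h.1 h.2.1 h.2.2.1 h.2.2.2)

/-- Action durations `L_a`, in slots. -/
def dur (M : AoInfModel) : AoAction → ℕ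
  | .idle => 1
  | .compute => M.CS
  | .tx => M.Utx
  | .offload => M.Uimg + M.CL

theorem dur_pos (M : AoInfModel) (a : AoAction) : 0 < M.dur a := by
  cases a
  · exact Nat.one_pos
  · exact M.CS_pos
  · exact M.Utx_pos
  · exact M.offload_pos

/-- Remaining visible time in a given contact phase. -/
def remaining (M : AoInfModel) (φ : ℕ) : ℕ := if φ < M.window then M.window - φ else 0

/-- Admissible actions. -/
def Feasible (M : AoInfModel) (s : M.State) : AoAction → Prop
  | .idle => True
  | .compute => True
  | .tx => s.cached = true ∧ M.Utx ≤ M.remaining s.phase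
  | .offload => M.Uimg ≤ M.remaining s.phase

/-- Probability that an action yields a task-valid ground update. -/
def succProb (M : AoInfModel) : AoAction → ℝ
  | .idle => 0
  | .compute => 0
  | .tx => M.pT
  | .offload => M.pO

/-- Ground age after the action without a task-valid update. -/
def ageFail (M : AoInfModel) (s : M.State) (a : AoAction) : ℕ := min (s.age + M.dur a) M.cap

/-- Ground age after the action with a task-valid update. Success has probability `0` for `idle`
and `compute`, so their values are irrelevant. -/
def ageSucc (M : AoInfModel) (s : M.State) : AoAction → ℕ
  | .idle => M.ageFail s .idle
  | .compute => M.ageFail s .compute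
  | .tx => min (s.cacheAge + M.dur .tx) M.cap
  | .offload => min (M.dur .offload) M.cap

/-- Cache occupancy after the action. -/
def nextCached (M : AoInfModel) (s : M.State) : AoAction → Bool
  | .idle => s.cached
  | .compute => true
  | .tx => false
  | .offload => s.cached

/-- Cache age after the action. -/
def nextCacheAge (M : AoInfModel) (s : M.State) : AoAction → ℕ
  | .idle => if s.cached then min (s.cacheAge + M.dur .idle) M.cap else 0
  | .compute => min (M.dur .compute) M.cap
  | .tx => 0
  | .offload => if s.cached then min (s.cacheAge + M.dur .offload) M.cap else 0

/-- State after the action, given whether it yields a task-valid update. -/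
def next (M : AoInfModel) (s : M.State) (a : AoAction) (success : Bool) : M.State where
  age := if success then M.ageSucc s a else M.ageFail s a
  phase := (s.phase + M.dur a) % M.period
  cached := M.nextCached s a
  cacheAge := M.nextCacheAge s a
  age_pos := by
    have hc := M.cap_pos
    have hd := M.dur_pos a
    have h := s.age_pos
    cases success <;> cases a <;> simp [ageSucc, ageFail] <;> omega
  age_le := by
    cases success <;> cases a <;> simp [ageSucc, ageFail]
  phase_lt := Nat.mod_lt _ M.period_pos
  cacheAge_le := by
    cases a <;> simp [nextCacheAge] <;> split_ifs <;> simp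
  cacheAge_empty := by
    cases a <;> simp +contextual [nextCached, nextCacheAge]

/-- SMDP transition probability `P(s' ∣ s, a)`. -/
noncomputable def kernel (M : AoInfModel) (s : M.State) (a : AoAction) (s' : M.State) : ℝ :=
  (1 - M.succProb a) * (if s' = M.next s a false then 1 else 0)
    + M.succProb a * (if s' = M.next s a true then 1 else 0)

/-- SMDP one-step cost `R(Δ, a)`: the age accumulated during the execution of the action. -/
noncomputable def cost (M : AoInfModel) (s : M.State) (a : AoAction) : ℝ :=
  ∑ i ∈ Finset.range (M.dur a), ((min (s.age + i) M.cap : ℕ) : ℝ)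

/-- Ground age in slot `n` along a sequence of pairs (state, action), where the first epoch starts
in slot `0`: it is `min (Δ + i) cap` in the `i`-th slot of an action that was started with ground
age `Δ`. Since all durations are at least one slot, `n + 1` epochs determine it; the value on
shorter sequences is a default. -/
def slotAge (M : AoInfModel) : List (M.State × AoAction) → ℕ → ℕ
  | [], _ => 0
  | (s, a) :: l, n => if n < M.dur a then min (s.age + n) M.cap else slotAge M l (n - M.dur a)

/-- Long-run average AoInf per slot of the SMDP under the policy `π` from the initial state `s`. -/
noncomputable def smdpAvg (M : AoInfModel) (π : Policy M.Feasible) (s : M.State) : ℝ :=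
  limsup (fun N : ℕ =>
    (1 / (N : ℝ)) * pathExpect M.kernel π s N
      (fun l => ∑ n ∈ Finset.range N, (M.slotAge l n : ℝ))) atTop

/-- One-step cost of the transformed MDP. -/
noncomputable def mdpCost (M : AoInfModel) (θ : ℝ) (s : M.State) (a : AoAction) : ℝ :=
  θ * (M.cost s a / (M.dur a : ℝ))

/-- Transition probability of the transformed MDP. -/
noncomputable def mdpKernel (M : AoInfModel) (θ : ℝ) (s : M.State) (a : AoAction)
    (s' : M.State) : ℝ :=
  if s' ≠ s then θ / (M.dur a : ℝ) * M.kernel s a s'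
  else 1 - θ / (M.dur a : ℝ) + θ / (M.dur a : ℝ) * M.kernel s a s

/-- Long-run average cost per step of the transformed MDP. -/
noncomputable def mdpAvg (M : AoInfModel) (θ : ℝ) (π : Policy M.Feasible) (s : M.State) : ℝ :=
  limsup (fun N : ℕ =>
    (1 / (N : ℝ)) * pathExpect (M.mdpKernel θ) π s N
      (fun l => (l.map (fun x => M.mdpCost θ x.1 x.2)).sum)) atTop

/-- The stationary policy `σ` is average-optimal, among all policies, from the initial state `s`
in the SMDP. -/
def SmdpOptimalFrom (M : AoInfModel) (s : M.State) (σ : StationaryPolicy M.Feasible) : Prop :=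
  ∀ π : Policy M.Feasible, M.smdpAvg σ.toPolicy s ≤ M.smdpAvg π s

/-- The stationary policy `σ` is average-optimal, among all policies, from the initial state `s`
in the transformed MDP. -/
def MdpOptimalFrom (M : AoInfModel) (θ : ℝ) (s : M.State) (σ : StationaryPolicy M.Feasible) :
    Prop :=
  ∀ π : Policy M.Feasible, M.mdpAvg θ σ.toPolicy s ≤ M.mdpAvg θ π s

end AoInfModel

/-! Everything rests on one solution (ρ, w) of the average-cost optimality equation: the reduced
cost g(s, a) = R(s, a) + Σ P(t | s, a) w(t) − w(s) − ρ L_a is nonnegative on admissible pairs and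
vanishes for some admissible action in every state (`exists_optimality_equation`). Telescoping w
shows that the expected cost of any policy over N slots is ρN plus an expected total of g, up to a
bounded error; the number of epochs that enter this total lies roughly between N / `maxDur` and N.
So every average is at least ρ, with equality iff the expected total of g grows sublinearly
(`smdpAvg_spec`). In the transformed MDP the same w works: g is multiplied by θ / L_a and the gain
becomes θρ (`reducedCost_mdp`, `mdpAvg_spec`).

Under a stationary policy, sublinear growth depends only on which transitions between distinct
states are possible and on where the mean of g vanishes (`tendsto_chainSum_div_iff`). The
transformation changes neither, even for randomized policies, where the factor θ / L_a varies with
the action chosen.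

The optimality equation comes from vanishing discount, which needs discounted values of uniformly
bounded oscillation. No recurrence assumption is made. From any state, computing and then idling
leads surely, in bounded time, to a filled cache in any prescribed phase. From there the actions of
any state with that phase can be copied, and the cap makes the copied ages no worse after `cap`
slots (`Dominates`, `IsRegularValue.oscillation`). -/

/-! ## Long-run averages along a finite Markov chain -/

/-- Expected sum of `d` over the first `n` states of the chain with transition matrix `P`. -/
noncomputable def chainSum {S : Type} [Fintype S] (P : S → S → ℝ) (d : S → ℝ) : ℕ → S → ℝ
  | 0, _ => 0
  | n + 1, s => d s + ∑ t, P s t * chainSum P d n t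

/-- Reachability in the chain with transition matrix `P`. -/
def Reach {S : Type} (P : S → S → ℝ) : S → S → Prop :=
  Relation.ReflTransGen (fun s t => 0 < P s t)

/-- Row-stochastic matrices. -/
structure IsStochastic {S : Type} [Fintype S] (P : S → S → ℝ) : Prop where
  nonneg : ∀ s t, 0 ≤ P s t
  sum_one : ∀ s, ∑ t, P s t = 1

section Chain

variable {S : Type} {P Q : S → S → ℝ} {d : S → ℝ}

theorem Reach.of_offDiag (h : ∀ s t, s ≠ t → 0 < P s t → 0 < Q s t) {s t : S}
    (hst : Reach P s t) : Reach Q s t := by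
  induction hst with
  | refl => exact Relation.ReflTransGen.refl
  | @tail b c _ hbc ih =>
    by_cases e : b = c
    · exact e ▸ ih
    · exact ih.tail (h b c e hbc)

theorem reach_iff_of_offDiag (h : ∀ s t, s ≠ t → (0 < P s t ↔ 0 < Q s t)) (s t : S) :
    Reach P s t ↔ Reach Q s t :=
  ⟨Reach.of_offDiag fun s t e => (h s t e).1, Reach.of_offDiag fun s t e => (h s t e).2⟩

variable [Fintype S]

namespace IsStochastic

theorem chainSum_nonneg (hP : IsStochastic P) (hd : ∀ s, 0 ≤ d s) (n : ℕ) (s : S) :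
    0 ≤ chainSum P d n s := by
  induction n generalizing s with
  | zero => exact le_rfl
  | succ n ih =>
    exact add_nonneg (hd s) (Finset.sum_nonneg fun t _ => mul_nonneg (hP.nonneg s t) (ih t))

theorem chainSum_mono_succ (hP : IsStochastic P) (hd : ∀ s, 0 ≤ d s) (n : ℕ) (s : S) :
    chainSum P d n s ≤ chainSum P d (n + 1) s := by
  induction n generalizing s with
  | zero => exact hP.chainSum_nonneg hd 1 s
  | succ n ih =>
    exact add_le_add le_rfl
      (Finset.sum_le_sum fun t _ => mul_le_mul_of_nonneg_left (ih t) (hP.nonneg s t))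

theorem chainSum_monotone (hP : IsStochastic P) (hd : ∀ s, 0 ≤ d s) (s : S) :
    Monotone fun n => chainSum P d n s :=
  monotone_nat_of_le_succ fun n => hP.chainSum_mono_succ hd n s

theorem mul_chainSum_le (hP : IsStochastic P) (hd : ∀ s, 0 ≤ d s) (n : ℕ) (s t : S) :
    P s t * chainSum P d n t ≤ chainSum P d (n + 1) s := by
  have h := Finset.single_le_sum (f := fun t => P s t * chainSum P d n t)
    (fun t _ => mul_nonneg (hP.nonneg s t) (hP.chainSum_nonneg hd n t)) (Finset.mem_univ t)
  have h2 := hd s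
  simp only [chainSum]
  linarith

/-- Expected values of `f` after `n` steps. -/
noncomputable def _root_.chainExp {S : Type} [Fintype S] (P : S → S → ℝ) (f : S → ℝ) :
    ℕ → S → ℝ
  | 0, s => f s
  | n + 1, s => ∑ t, P s t * chainExp P f n t

theorem chainSum_le_of_le (hP : IsStochastic P) {f : S → ℝ} {B : ℝ} (h : ∀ s, d s ≤ B * f s)
    (n : ℕ) (s : S) : chainSum P d n s ≤ B * ∑ k ∈ Finset.range n, chainExp P f k s := by
  induction n generalizing s with
  | zero => simp [chainSum]
  | succ n ih =>
    rw [Finset.sum_range_succ', chainSum]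
    have h1 : ∑ t, P s t * chainSum P d n t
        ≤ ∑ t, P s t * (B * ∑ k ∈ Finset.range n, chainExp P f k t) :=
      Finset.sum_le_sum fun t _ => mul_le_mul_of_nonneg_left (ih t) (hP.nonneg s t)
    have h2 : ∑ t, P s t * (B * ∑ k ∈ Finset.range n, chainExp P f k t)
        = B * ∑ k ∈ Finset.range n, chainExp P f (k + 1) s := by
      simp only [chainExp, Finset.mul_sum]
      rw [Finset.sum_comm]
      refine Finset.sum_congr rfl fun k _ => Finset.sum_congr rfl fun t _ => by ring
    have h3 := h s
    simp only [chainExp] at *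
    linarith

/-- A function harmonic on a reachable set attains its maximum there on everything reachable from
a maximiser. -/
theorem eq_of_harmonic_of_max (hP : IsStochastic P) {p : S → ℝ} {s : S}
    (hharm : ∀ t, Reach P s t → p t = ∑ u, P t u * p u) {m : S} (hm : Reach P s m)
    (hmax : ∀ t, Reach P s t → p t ≤ p m) {u : S} (hu : Reach P m u) : p u = p m := by
  induction hu with
  | refl => rfl
  | @tail b c hmb hbc ih =>
    have hsb : Reach P s b := Relation.ReflTransGen.trans hm hmb
    -- The gaps `p m - p x` are nonnegative on successors and average to zero, so each vanishes on
    -- every successor of positive probability.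
    have h0 : ∑ x, P b x * (p m - p x) = 0 := by
      simp only [mul_sub, Finset.sum_sub_distrib, ← Finset.sum_mul, hP.sum_one, one_mul]
      rw [← hharm b hsb, ih, sub_self]
    have hnn : ∀ x ∈ Finset.univ, 0 ≤ P b x * (p m - p x) := fun x _ => by
      rcases (hP.nonneg b x).eq_or_lt with e | e
      · rw [← e, zero_mul]
      · exact mul_nonneg e.le (sub_nonneg.2 (hmax x (hsb.tail e)))
    have := (Finset.sum_eq_zero_iff_of_nonneg hnn).1 h0 c (Finset.mem_univ c)
    rcases mul_eq_zero.1 this with e | e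
    · exact absurd e hbc.ne'
    · linarith

/-- The expectation is the probability of being outside the closed set `Z` at time `n`. It decreases
to a harmonic function that is zero on `Z`; its maximum over the reachable states propagates along a
path into `Z`, so it is zero. -/
theorem tendsto_chainExp_indicator (hP : IsStochastic P) {Z : Set S}
    (hZ : ∀ u ∈ Z, ∀ w, 0 < P u w → w ∈ Z) {s : S}
    (hs : ∀ t, Reach P s t → ∃ u, Reach P t u ∧ u ∈ Z) :
    Tendsto (fun n => chainExp P (fun t => if t ∈ Z then 0 else 1) n s) atTop (nhds 0) := by
  set f : S → ℝ := fun t => if t ∈ Z then 0 else 1 with hf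
  have hnn : ∀ n t, 0 ≤ chainExp P f n t := by
    intro n
    induction n with
    | zero => intro t; simp only [chainExp, hf]; split_ifs <;> norm_num
    | succ n ih => exact fun t => Finset.sum_nonneg fun u _ => mul_nonneg (hP.nonneg t u) (ih u)
  have hz : ∀ n, ∀ t ∈ Z, chainExp P f n t = 0 := by
    intro n
    induction n with
    | zero => intro t ht; simp [chainExp, hf, ht]
    | succ n ih =>
      intro t ht
      refine Finset.sum_eq_zero fun u _ => ?_
      rcases (hP.nonneg t u).eq_or_lt with e | e
      · rw [← e, zero_mul]
      · rw [ih u (hZ t ht u e), mul_zero]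
  have hanti : ∀ n t, chainExp P f (n + 1) t ≤ chainExp P f n t := by
    intro n
    induction n with
    | zero =>
      intro t
      by_cases ht : t ∈ Z
      · rw [hz _ t ht, hz _ t ht]
      · calc chainExp P f 1 t ≤ ∑ u, P t u * 1 :=
              Finset.sum_le_sum fun u _ => mul_le_mul_of_nonneg_left
                (by simp only [chainExp, hf]; split_ifs <;> norm_num) (hP.nonneg t u)
          _ = chainExp P f 0 t := by simp [hP.sum_one, chainExp, hf, ht]
    | succ n ih =>
      exact fun t => Finset.sum_le_sum fun u _ => mul_le_mul_of_nonneg_left (ih u) (hP.nonneg t u)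
  set p : S → ℝ := fun t => ⨅ n, chainExp P f n t with hp
  have hlim : ∀ t, Tendsto (fun n => chainExp P f n t) atTop (nhds (p t)) := fun t =>
    tendsto_atTop_ciInf (antitone_nat_of_succ_le fun n => hanti n t)
      ⟨0, by rintro _ ⟨n, rfl⟩; exact hnn n t⟩
  have hharm : ∀ t, p t = ∑ u, P t u * p u := fun t =>
    tendsto_nhds_unique ((tendsto_add_atTop_iff_nat 1).2 (hlim t))
      (tendsto_finsetSum _ fun u _ => (hlim u).const_mul (P t u))
  have hpz : ∀ t ∈ Z, p t = 0 := fun t ht => by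
    simp only [hp, hz _ t ht, ciInf_const]
  obtain ⟨m, hm, hmax⟩ := (Set.toFinite {t | Reach P s t}).exists_maximalFor p _
    ⟨s, Relation.ReflTransGen.refl⟩
  have hmax' : ∀ t, Reach P s t → p t ≤ p m := fun t ht => by
    rcases le_total (p m) (p t) with h | h
    · exact hmax ht h
    · exact h
  obtain ⟨u, hmu, huZ⟩ := hs m hm
  have h1 := hP.eq_of_harmonic_of_max (fun t _ => hharm t) hm hmax' hmu
  have h2 : p s = 0 := le_antisymm
    ((hmax' s Relation.ReflTransGen.refl).trans (by rw [← h1, hpz u huZ]))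
    (ge_of_tendsto' (hlim s) fun n => hnn n s)
  exact h2 ▸ hlim s

theorem tendsto_chainSum_div_of_step (hP : IsStochastic P) (hd : ∀ s, 0 ≤ d s) {s t : S}
    (h : Tendsto (fun n : ℕ => chainSum P d n s / n) atTop (nhds 0)) (hst : Reach P s t) :
    Tendsto (fun n : ℕ => chainSum P d n t / n) atTop (nhds 0) := by
  induction hst with
  | refl => exact h
  | @tail b c _ hbc ih =>
    -- The factor 2 absorbs the shift of horizon: n + 1 ≤ 2n for n ≥ 1.
    have h1 : Tendsto (fun n : ℕ => 2 / P b c * (chainSum P d (n + 1) b / ((n + 1 : ℕ) : ℝ)))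
        atTop (nhds (2 / P b c * 0)) :=
      ((tendsto_add_atTop_iff_nat 1).2 ih).const_mul _
    rw [mul_zero] at h1
    refine squeeze_zero' (Eventually.of_forall fun n => ?_) ?_ h1
    · exact div_nonneg (hP.chainSum_nonneg hd n c) (Nat.cast_nonneg n)
    · filter_upwards [eventually_ge_atTop 1] with n hn
      have hn' : (1 : ℝ) ≤ n := by exact_mod_cast hn
      have h2 := hP.mul_chainSum_le hd n b c
      have h3 := hP.chainSum_nonneg hd n c
      push_cast
      rw [div_mul_div_comm, div_le_div_iff₀ (by linarith) (by positivity)]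
      nlinarith [mul_nonneg h3 hbc.le]

/-- The long-run average of a nonnegative function vanishes iff from everywhere one can reach a
state from which only zeros of the function are reachable. -/
theorem tendsto_chainSum_div_iff (hP : IsStochastic P) (hd : ∀ s, 0 ≤ d s) (s : S) :
    Tendsto (fun n : ℕ => chainSum P d n s / n) atTop (nhds 0) ↔
      ∀ t, Reach P s t → ∃ u, Reach P t u ∧ ∀ w, Reach P u w → d w = 0 := by
  constructor
  · intro h t hst
    by_contra! hne
    have ht := hP.tendsto_chainSum_div_of_step hd h hst
    have hpos : ∀ u w, Reach P u w → d w ≠ 0 → ∃ n, 0 < chainSum P d n u := by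
      intro u w huw hw
      induction huw using Relation.ReflTransGen.head_induction_on with
      | refl => exact ⟨1, by simpa [chainSum] using lt_of_le_of_ne (hd w) hw.symm⟩
      | @head a b hab _ ih =>
        obtain ⟨n, hn⟩ := ih
        exact ⟨n + 1, (mul_pos hab hn).trans_le (hP.mul_chainSum_le hd n a b)⟩
    have hpos' : ∀ u, ∃ n, Reach P t u → 0 < chainSum P d n u := fun u => by
      by_cases hu : Reach P t u
      · obtain ⟨w, huw, hw⟩ := hne u hu
        obtain ⟨n, hn⟩ := hpos u w huw hw
        exact ⟨n, fun _ => hn⟩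
      · exact ⟨0, fun h => absurd h hu⟩
    choose nn hnn using hpos'
    -- One horizon for all states: the sums increase in the horizon, so `n` makes all of them
    -- positive at once on the finite reachable set. With minimum `c`, each block of `n` steps then
    -- contributes at least `c`, and the average stays above `c / n`.
    set n := ∑ u, nn u with hn
    have hn' : ∀ u, Reach P t u → 0 < chainSum P d n u := fun u hu =>
      (hnn u hu).trans_le (hP.chainSum_monotone hd u
        (Finset.single_le_sum (f := nn) (fun _ _ => Nat.zero_le _) (Finset.mem_univ u)))
    obtain ⟨m, hm, hmin⟩ := (Set.toFinite {u | Reach P t u}).exists_minimalFor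
      (fun u => chainSum P d n u) _ ⟨t, Relation.ReflTransGen.refl⟩
    set c := chainSum P d n m with hc
    have hcpos : 0 < c := hn' m hm
    have hmin' : ∀ u, Reach P t u → c ≤ chainSum P d n u := fun u hu => by
      rcases le_total (chainSum P d n u) c with h | h
      · exact hmin hu h
      · exact h
    -- Superadditivity: after any `j` steps the chain is still in the reachable set, so `k` further
    -- steps add at least `r`.
    have hadd : ∀ (r : ℝ) (k : ℕ), (∀ u, Reach P t u → r ≤ chainSum P d k u) →
        ∀ j u, Reach P t u → chainSum P d j u + r ≤ chainSum P d (j + k) u := by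
      intro r k hr j
      induction j with
      | zero => intro u hu; simpa [chainSum] using hr u hu
      | succ j ih =>
        intro u hu
        rw [Nat.add_right_comm, chainSum, chainSum, add_assoc]
        refine add_le_add le_rfl ?_
        have : r = ∑ w, P u w * r := by rw [← Finset.sum_mul, hP.sum_one, one_mul]
        rw [this, ← Finset.sum_add_distrib]
        refine Finset.sum_le_sum fun w _ => ?_
        rw [← mul_add]
        rcases (hP.nonneg u w).eq_or_lt with e | e
        · rw [← e, zero_mul, zero_mul]
        · exact mul_le_mul_of_nonneg_left (ih w (hu.tail e)) e.le
    have hmul : ∀ k : ℕ, ∀ u, Reach P t u → (k : ℝ) * c ≤ chainSum P d (n * k) u := by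
      intro k
      induction k with
      | zero => intro u _; simp [chainSum]
      | succ k ih =>
        intro u hu
        have := hadd _ _ ih n u hu
        have h2 := hmin' u hu
        rw [mul_add, mul_one, add_comm (n * k)]
        push_cast
        linarith
    have hn0 : 0 < n := by
      rcases Nat.eq_zero_or_pos n with e | e
      · rw [hc, e] at hcpos; exact absurd hcpos (lt_irrefl _)
      · exact e
    have hsub : Tendsto (fun k : ℕ => n * k) atTop atTop := tendsto_id.const_mul_atTop' hn0
    have := ge_of_tendsto (ht.comp hsub) (b := c / n) (by
      filter_upwards [eventually_ge_atTop 1] with k hk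
      have hk' : (0 : ℝ) < k := by exact_mod_cast hk
      have hn1 : (0 : ℝ) < n := by exact_mod_cast hn0
      simp only [Function.comp]
      rw [Nat.cast_mul, div_le_div_iff₀ hn1 (by positivity)]
      nlinarith [hmul k t Relation.ReflTransGen.refl])
    have : 0 < c / n := div_pos hcpos (by exact_mod_cast hn0)
    linarith
  · intro h
    -- Outside `Z` the function is at most its total sum, and on `Z` it is zero. So its average is
    -- controlled by the Cesàro mean of the probabilities of being outside `Z`.
    set Z : Set S := {u | ∀ w, Reach P u w → d w = 0} with hZ
    have hlim := hP.tendsto_chainExp_indicator (Z := Z)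
      (fun u hu w huw x hwx => hu x (Relation.ReflTransGen.head huw hwx)) h
    have hces := hlim.cesaro.const_mul (∑ t, d t)
    rw [mul_zero] at hces
    refine squeeze_zero (fun n => div_nonneg (hP.chainSum_nonneg hd n s) (Nat.cast_nonneg n))
      (fun n => ?_) hces
    have := hP.chainSum_le_of_le (d := d) (B := ∑ t, d t)
      (f := fun t => if t ∈ Z then 0 else 1) (fun t => by
        by_cases ht : t ∈ Z
        · simp [ht, ht t Relation.ReflTransGen.refl]
        · simpa [ht] using Finset.single_le_sum (f := d) (fun t _ => hd t) (Finset.mem_univ t))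
      n s
    rw [div_eq_inv_mul]
    exact (mul_le_mul_of_nonneg_left this (by positivity)).trans_eq
      (by convert mul_left_comm _ _ _)

end IsStochastic

end Chain

/-! ## Expectations along a controlled process, recursively -/

/-- Expectation of a function of the next `n` pairs (state, action) after the history `h`, with the
next state distributed as `μ`. -/
noncomputable def histExpect {S A : Type} [Fintype S] [Fintype A] {feas : S → A → Prop}
    (K : S → A → S → ℝ) (π : Policy feas) :
    List (S × A) → (S → ℝ) → ℕ → (List (S × A) → ℝ) → ℝ
  | _, _, 0, f => f []
  | h, μ, n + 1, f => ∑ s, μ s * ∑ a, π.prob h s a *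
      histExpect K π (h ++ [(s, a)]) (K s a) n (fun l => f ((s, a) :: l))

/-- Expected total of `g` over the next `n` epochs after the history `h`, with the next state
distributed as `μ`. -/
noncomputable def totalExpect {S A : Type} [Fintype S] [Fintype A] {feas : S → A → Prop}
    (K : S → A → S → ℝ) (π : Policy feas) (g : S → A → ℝ) :
    List (S × A) → (S → ℝ) → ℕ → ℝ
  | _, _, 0 => 0
  | h, μ, n + 1 => ∑ s, μ s * ∑ a, π.prob h s a *
      (g s a + totalExpect K π g (h ++ [(s, a)]) (K s a) n)

/-- Probability vectors. -/
structure IsDist {S : Type} [Fintype S] (μ : S → ℝ) : Prop where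
  nonneg : ∀ s, 0 ≤ μ s
  sum_one : ∑ s, μ s = 1

section Expect

variable {S A : Type} [Fintype A] {feas : S → A → Prop} {K : S → A → S → ℝ} {π : Policy feas}

theorem sum_policy_mul_const (h : List (S × A)) (s : S) (c : ℝ) :
    ∑ a, π.prob h s a * c = c := by
  rw [← Finset.sum_mul, π.sum_one, one_mul]

theorem sum_policy_le {h : List (S × A)} {s : S} {f g : A → ℝ}
    (hfg : ∀ a, feas s a → f a ≤ g a) :
    ∑ a, π.prob h s a * f a ≤ ∑ a, π.prob h s a * g a := by
  refine Finset.sum_le_sum fun a _ => ?_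
  by_cases ha : feas s a
  · exact mul_le_mul_of_nonneg_left (hfg a ha) (π.nonneg h s a)
  · rw [π.support h s a ha, zero_mul, zero_mul]

/-- Transition matrix of the chain of states under a stationary policy. -/
noncomputable def StationaryPolicy.matrix (σ : StationaryPolicy feas) (K : S → A → S → ℝ)
    (s t : S) : ℝ := ∑ a, σ.prob s a * K s a t

/-- Mean of `g` at each state under a stationary policy. -/
noncomputable def StationaryPolicy.mean (σ : StationaryPolicy feas) (g : S → A → ℝ) (s : S) : ℝ :=
  ∑ a, σ.prob s a * g s a

namespace StationaryPolicy

variable (σ : StationaryPolicy feas)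

theorem mean_term_nonneg {g : S → A → ℝ} (hg : ∀ s a, feas s a → 0 ≤ g s a) (s : S) (a : A) :
    0 ≤ σ.prob s a * g s a := by
  by_cases ha : feas s a
  · exact mul_nonneg (σ.nonneg s a) (hg s a ha)
  · rw [σ.support s a ha, zero_mul]

theorem mean_nonneg {g : S → A → ℝ} (hg : ∀ s a, feas s a → 0 ≤ g s a) (s : S) :
    0 ≤ σ.mean g s :=
  Finset.sum_nonneg fun a _ => σ.mean_term_nonneg hg s a

theorem mean_eq_zero_iff {g : S → A → ℝ} (hg : ∀ s a, feas s a → 0 ≤ g s a) (s : S) :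
    σ.mean g s = 0 ↔ ∀ a, σ.prob s a = 0 ∨ g s a = 0 := by
  rw [mean, Finset.sum_eq_zero_iff_of_nonneg fun a _ => σ.mean_term_nonneg hg s a]
  simp

theorem matrix_pos_iff {s t : S} (hK : ∀ a, 0 ≤ K s a t) :
    0 < σ.matrix K s t ↔ ∃ a, 0 < σ.prob s a ∧ 0 < K s a t := by
  have hnn : ∀ a ∈ Finset.univ, 0 ≤ σ.prob s a * K s a t := fun a _ =>
    mul_nonneg (σ.nonneg s a) (hK a)
  rw [matrix, Finset.sum_pos_iff_of_nonneg hnn]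
  constructor
  · rintro ⟨a, -, ha⟩
    have h1 : σ.prob s a ≠ 0 := fun e => by rw [e, zero_mul] at ha; exact lt_irrefl _ ha
    have h2 : K s a t ≠ 0 := fun e => by rw [e, mul_zero] at ha; exact lt_irrefl _ ha
    exact ⟨a, (σ.nonneg s a).lt_of_ne' h1, (hK a).lt_of_ne' h2⟩
  · rintro ⟨a, h1, h2⟩
    exact ⟨a, Finset.mem_univ a, mul_pos h1 h2⟩

end StationaryPolicy

variable [Fintype S]

theorem histExpect_eq_sum (h : List (S × A)) (μ : S → ℝ) (n : ℕ) (f : List (S × A) → ℝ) :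
    ∑ ω : Fin n → S × A, pathProb K π h μ (List.ofFn ω) * f (List.ofFn ω)
      = histExpect K π h μ n f := by
  induction n generalizing h μ f with
  | zero => simp [histExpect, pathProb]
  | succ n ih =>
    rw [← (Fin.consEquiv fun _ => S × A).sum_comp, Fintype.sum_prod_type, Fintype.sum_prod_type,
      histExpect]
    refine Finset.sum_congr rfl fun s _ => ?_
    rw [Finset.mul_sum]
    refine Finset.sum_congr rfl fun a _ => ?_
    rw [← ih, Finset.mul_sum, Finset.mul_sum]
    refine Finset.sum_congr rfl fun ω _ => ?_
    have e : List.ofFn ((Fin.consEquiv fun _ => S × A) ((s, a), ω)) = (s, a) :: List.ofFn ω :=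
      List.ofFn_cons _ _
    rw [e, pathProb]
    ring

theorem pathExpect_eq_histExpect (s : S) (n : ℕ) (f : List (S × A) → ℝ) :
    pathExpect K π s n f = histExpect K π [] (fun t => if t = s then 1 else 0) n f :=
  histExpect_eq_sum _ _ _ _

theorem isDist_point (s : S) : IsDist (fun t => if t = s then (1 : ℝ) else 0) :=
  ⟨fun t => by split_ifs <;> norm_num, by simp⟩

theorem IsDist.sum_mul_const {μ : S → ℝ} (hμ : IsDist μ) (c : ℝ) : ∑ s, μ s * c = c := by
  rw [← Finset.sum_mul, hμ.sum_one, one_mul]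

theorem IsDist.sum_mul_le {μ : S → ℝ} (hμ : IsDist μ) {f : S → ℝ} {c : ℝ} (h : ∀ s, f s ≤ c) :
    ∑ s, μ s * f s ≤ c := by
  rw [← hμ.sum_mul_const c]
  exact Finset.sum_le_sum fun s _ => mul_le_mul_of_nonneg_left (h s) (hμ.nonneg s)

theorem IsDist.le_sum_mul {μ : S → ℝ} (hμ : IsDist μ) {f : S → ℝ} {c : ℝ} (h : ∀ s, c ≤ f s) :
    c ≤ ∑ s, μ s * f s := by
  rw [← hμ.sum_mul_const c]
  exact Finset.sum_le_sum fun s _ => mul_le_mul_of_nonneg_left (h s) (hμ.nonneg s)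

theorem histExpect_const_add (hK : ∀ s a, IsDist (K s a)) (h : List (S × A)) {μ : S → ℝ}
    (hμ : IsDist μ) (n : ℕ) (r : ℝ) (f : List (S × A) → ℝ) :
    histExpect K π h μ n (fun l => r + f l) = r + histExpect K π h μ n f := by
  induction n generalizing h μ f with
  | zero => rfl
  | succ n ih =>
    simp only [histExpect, ih _ (hK _ _), mul_add, Finset.sum_add_distrib, sum_policy_mul_const,
      hμ.sum_mul_const]

theorem histExpect_sum_eq_totalExpect (hK : ∀ s a, IsDist (K s a)) (g : S → A → ℝ)
    (h : List (S × A)) (μ : S → ℝ) (n : ℕ) :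
    histExpect K π h μ n (fun l => (l.map fun x => g x.1 x.2).sum) = totalExpect K π g h μ n := by
  induction n generalizing h μ with
  | zero => simp [histExpect, totalExpect]
  | succ n ih =>
    simp only [histExpect, totalExpect, List.map_cons, List.sum_cons]
    refine Finset.sum_congr rfl fun s _ => ?_
    congr 1
    refine Finset.sum_congr rfl fun a _ => ?_
    rw [histExpect_const_add hK _ (hK s a), ih]

theorem totalExpect_nonneg (hK : ∀ s a, IsDist (K s a)) {g : S → A → ℝ}
    (hg : ∀ s a, feas s a → 0 ≤ g s a) (h : List (S × A)) {μ : S → ℝ} (hμ : IsDist μ) (n : ℕ) :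
    0 ≤ totalExpect K π g h μ n := by
  induction n generalizing h μ with
  | zero => exact le_rfl
  | succ n ih =>
    refine hμ.le_sum_mul fun s => ?_
    rw [← sum_policy_mul_const (π := π) h s 0]
    exact sum_policy_le fun a ha => add_nonneg (hg s a ha) (ih _ (hK s a))

/-- Evaluation of the expected total cost by a potential `w`: up to a bounded error it is the
linear term plus the expected total of the reduced costs. -/
theorem abs_totalExpect_sub_le (hK : ∀ s a, IsDist (K s a)) {c : S → A → ℝ} {w : S → ℝ} {ρ C : ℝ}
    (hC : ∀ s, |w s| ≤ C) (h : List (S × A)) {μ : S → ℝ} (hμ : IsDist μ) (n : ℕ) :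
    |totalExpect K π c h μ n - (ρ * n + ∑ s, μ s * w s
      + totalExpect K π (fun s a => c s a + ∑ t, K s a t * w t - w s - ρ) h μ n)| ≤ C := by
  set g : S → A → ℝ := fun s a => c s a + ∑ t, K s a t * w t - w s - ρ with hg
  induction n generalizing h μ with
  | zero =>
    simp only [totalExpect, Nat.cast_zero]
    rw [abs_le]
    have h1 := hμ.sum_mul_le fun s => (abs_le.1 (hC s)).2
    have h2 := hμ.le_sum_mul fun s => (abs_le.1 (hC s)).1
    constructor <;> linarith
  | succ n ih =>
    -- The potential telescopes: the error over `n + 1` epochs is exactly the mean of the errors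
    -- over the remaining `n` epochs, so the bound does not grow.
    have key : totalExpect K π c h μ (n + 1) - (ρ * (n + 1 : ℕ) + ∑ s, μ s * w s
        + totalExpect K π g h μ (n + 1))
        = ∑ s, μ s * ∑ a, π.prob h s a * (totalExpect K π c (h ++ [(s, a)]) (K s a) n
          - (ρ * n + ∑ t, K s a t * w t + totalExpect K π g (h ++ [(s, a)]) (K s a) n)) := by
      have e1 : ρ * ((n + 1 : ℕ) : ℝ) + ∑ s, μ s * w s
          = ∑ s, μ s * ∑ a, π.prob h s a * (ρ * (n + 1) + w s) := by
        simp only [sum_policy_mul_const]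
        simp only [mul_add (μ _) (ρ * _), Finset.sum_add_distrib, hμ.sum_mul_const]
        push_cast
        rfl
      rw [e1]
      simp only [totalExpect]
      rw [← Finset.sum_add_distrib, ← Finset.sum_sub_distrib]
      refine Finset.sum_congr rfl fun s _ => ?_
      rw [← mul_add, ← mul_sub, ← Finset.sum_add_distrib, ← Finset.sum_sub_distrib]
      congr 1
      refine Finset.sum_congr rfl fun a _ => ?_
      simp only [hg]
      ring
    rw [key, abs_le]
    constructor
    · refine hμ.le_sum_mul fun s => ?_
      rw [← sum_policy_mul_const (π := π) h s (-C)]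
      exact sum_policy_le fun a _ => (abs_le.1 (ih _ (hK s a))).1
    · refine hμ.sum_mul_le fun s => ?_
      rw [← sum_policy_mul_const (π := π) h s C]
      exact sum_policy_le fun a _ => (abs_le.1 (ih _ (hK s a))).2

namespace StationaryPolicy

variable (σ : StationaryPolicy feas)

theorem isStochastic_matrix (hK : ∀ s a, IsDist (K s a)) : IsStochastic (σ.matrix K) where
  nonneg s t := Finset.sum_nonneg fun a _ => mul_nonneg (σ.nonneg s a) ((hK s a).nonneg t)
  sum_one s := by
    simp only [matrix]
    rw [Finset.sum_comm]
    simp only [← Finset.mul_sum, (hK _ _).sum_one, mul_one, σ.sum_one]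

theorem totalExpect_eq_chainSum (g : S → A → ℝ) (h : List (S × A)) (μ : S → ℝ) (n : ℕ) :
    totalExpect K σ.toPolicy g h μ n
      = ∑ s, μ s * chainSum (σ.matrix K) (σ.mean g) n s := by
  induction n generalizing h μ with
  | zero => simp [totalExpect, chainSum]
  | succ n ih =>
    simp only [totalExpect, chainSum, ih]
    refine Finset.sum_congr rfl fun s _ => ?_
    congr 1
    simp only [mul_add, Finset.sum_add_distrib, StationaryPolicy.matrix, Finset.sum_mul]
    refine congrArg₂ _ rfl ?_
    rw [Finset.sum_comm]
    simp only [Finset.mul_sum, mul_assoc]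
    rfl

end StationaryPolicy

end Expect

/-! ## Average-cost optimality equation by vanishing discount -/

section Bellman

variable {S A : Type} [Fintype S]

/-- One-step value of the action `a` in state `s` for the terminal value `v`, with discount factor
`1 - ε * L a`. -/
noncomputable def actionValue (K : S → A → S → ℝ) (c : S → A → ℝ) (L : A → ℝ) (ε : ℝ)
    (v : S → ℝ) (s : S) (a : A) : ℝ :=
  c s a + (1 - ε * L a) * ∑ t, K s a t * v t

variable {K : S → A → S → ℝ} {c : S → A → ℝ} {L : A → ℝ} {ε : ℝ}

/-- Monotonicity and contraction in one inequality: since durations are at least one, no discount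
factor exceeds `1 - ε`. -/
theorem actionValue_le_add (hK : ∀ s a, IsDist (K s a)) (hε : 0 ≤ ε) (hL : ∀ a, 1 ≤ L a)
    (hεL : ∀ a, ε * L a ≤ 1) {v w : S → ℝ} {D : ℝ} (hD : 0 ≤ D) (hvw : ∀ s, v s ≤ w s + D)
    (s : S) (a : A) :
    actionValue K c L ε v s a ≤ actionValue K c L ε w s a + (1 - ε) * D := by
  have h1 : ∑ t, K s a t * v t ≤ ∑ t, K s a t * w t + D := by
    rw [← (hK s a).sum_mul_const D, ← Finset.sum_add_distrib]
    refine Finset.sum_le_sum fun t _ => ?_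
    rw [← mul_add]
    exact mul_le_mul_of_nonneg_left (hvw t) ((hK s a).nonneg t)
  have h2 := mul_le_mul_of_nonneg_left h1 (sub_nonneg.2 (hεL a))
  have h3 : ε * D * 1 ≤ ε * D * L a := mul_le_mul_of_nonneg_left (hL a) (mul_nonneg hε hD)
  unfold actionValue
  nlinarith

variable [Fintype A] {feas : S → A → Prop}

/-- The discounted optimality equation has a solution with every closed property that the zero
function has and that is passed on by value iteration. -/
theorem exists_discounted_solution (hfeas : ∀ s, ∃ a, feas s a) (hK : ∀ s a, IsDist (K s a))
    (hε : 0 < ε) (hL : ∀ a, 1 ≤ L a) (hεL : ∀ a, ε * L a ≤ 1) (p : (S → ℝ) → Prop)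
    (hcl : IsClosed {v | p v}) (h0 : p 0)
    (hstep : ∀ v w : S → ℝ, p v → (∀ s a, feas s a → w s ≤ actionValue K c L ε v s a) →
      (∀ s, ∃ a, feas s a ∧ w s = actionValue K c L ε v s a) → p w) :
    ∃ v : S → ℝ, p v ∧ (∀ s a, feas s a → v s ≤ actionValue K c L ε v s a) ∧
      ∀ s, ∃ a, feas s a ∧ v s = actionValue K c L ε v s a := by
  have hne : ∀ s, (Finset.univ.filter fun a => feas s a).Nonempty := fun s => by
    obtain ⟨a, ha⟩ := hfeas s
    exact ⟨a, by simp [ha]⟩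
  let T : (S → ℝ) → S → ℝ := fun v s => (Finset.univ.filter fun a => feas s a).inf' (hne s)
    (actionValue K c L ε v s)
  have hT1 : ∀ v s a, feas s a → T v s ≤ actionValue K c L ε v s a := fun v s a ha =>
    Finset.inf'_le _ (by simp [ha])
  have hT2 : ∀ v s, ∃ a, feas s a ∧ T v s = actionValue K c L ε v s a := fun v s => by
    obtain ⟨a, ha, h⟩ := Finset.exists_mem_eq_inf' (hne s) (actionValue K c L ε v s)
    exact ⟨a, (Finset.mem_filter.1 ha).2, h⟩
  have hε1 : ∀ _ : S, ε ≤ 1 := fun s => by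
    obtain ⟨a, -⟩ := hfeas s
    nlinarith [hL a, hεL a]
  have hTle : ∀ (v w : S → ℝ) s, T v s ≤ T w s + (1 - ε) * dist v w := fun v w s => by
    obtain ⟨a, ha, h⟩ := hT2 w s
    rw [h]
    refine (hT1 v s a ha).trans (actionValue_le_add hK hε.le hL hεL dist_nonneg (fun t => ?_) s a)
    have := (abs_le.1 ((Real.dist_eq _ _).symm.le.trans (dist_le_pi_dist v w t))).2
    linarith
  have hcontr : ContractingWith (Real.toNNReal (1 - ε)) T := by
    refine ⟨by rw [← NNReal.coe_lt_coe, Real.coe_toNNReal']; simp [hε], ?_⟩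
    refine LipschitzWith.of_dist_le_mul fun v w => ?_
    have hnn : (1 - ε) * dist v w ≤ (Real.toNNReal (1 - ε) : ℝ) * dist v w :=
      mul_le_mul_of_nonneg_right (Real.le_coe_toNNReal _) dist_nonneg
    refine (dist_pi_le_iff (by positivity)).2 fun s => ?_
    rw [Real.dist_eq, abs_le]
    have h1 := hTle v w s
    have h2 := hTle w v s
    rw [dist_comm w v] at h2
    constructor <;> linarith
  have hfix := hcontr.fixedPoint_isFixedPt
  set v := hcontr.fixedPoint T with hv
  have hfix' : ∀ s, T v s = v s := fun s => congrFun hfix s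
  refine ⟨v, ?_, fun s a ha => (hfix' s) ▸ hT1 v s a ha, fun s => (hfix' s) ▸ hT2 v s⟩
  refine hcl.mem_of_tendsto (hcontr.tendsto_iterate_fixedPoint 0) (Eventually.of_forall fun n => ?_)
  induction n with
  | zero => exact h0
  | succ n ih =>
    rw [Function.iterate_succ_apply']
    exact hstep _ _ ih (hT1 _) (hT2 _)

/-- Vanishing discount: if the discounted optimality equations have solutions of uniformly bounded
oscillation, then the average-cost optimality equation has a solution. -/
theorem exists_average_solution [Nonempty S] {C B ε₀ : ℝ} (hε₀ : 0 < ε₀)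
    (hK : ∀ s a, IsDist (K s a))
    (hsol : ∀ ε, 0 < ε → ε ≤ ε₀ → ∃ v : S → ℝ,
      (∀ s, 0 ≤ v s ∧ ε * v s ≤ B) ∧ (∀ s t, v s ≤ v t + C) ∧
      (∀ s a, feas s a → v s ≤ actionValue K c L ε v s a) ∧
      ∀ s, ∃ a, feas s a ∧ v s = actionValue K c L ε v s a) :
    ∃ (ρ : ℝ) (w : S → ℝ),
      (∀ s a, feas s a → 0 ≤ c s a + ∑ t, K s a t * w t - w s - ρ * L a) ∧
      ∀ s, ∃ a, feas s a ∧ c s a + ∑ t, K s a t * w t - w s - ρ * L a = 0 := by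
  obtain ⟨z⟩ := ‹Nonempty S›
  have hεn : ∀ n : ℕ, 0 < ε₀ * (1 / ((n : ℝ) + 1)) := fun n => by positivity
  have hεn' : ∀ n : ℕ, ε₀ * (1 / ((n : ℝ) + 1)) ≤ ε₀ := fun n => by
    have : (1 : ℝ) / (n + 1) ≤ 1 := by
      rw [div_le_one (by positivity)]
      linarith [(Nat.cast_nonneg n : (0 : ℝ) ≤ n)]
    nlinarith
  choose v hv0 hvC hv1 hv2 using fun n => hsol _ (hεn n) (hεn' n)
  set e : ℕ → ℝ := fun n => ε₀ * (1 / ((n : ℝ) + 1)) with he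
  have he0 : Tendsto e atTop (nhds 0) := by
    simpa only [mul_zero] using tendsto_one_div_add_atTop_nhds_zero_nat.const_mul ε₀
  -- Values are normalised at the reference state `z`, and `e n * v n z` is the candidate for the
  -- gain. The oscillation bound and the bound `B` keep both in a compact set.
  let x : ℕ → (S → ℝ) × ℝ := fun n => (fun s => v n s - v n z, e n * v n z)
  have hcomp : IsCompact ((Set.univ.pi fun _ : S => Set.Icc (-C) C) ×ˢ Set.Icc 0 B) :=
    (isCompact_univ_pi fun _ => isCompact_Icc).prod isCompact_Icc
  obtain ⟨⟨w, ρ⟩, -, φ, hφ, hlim⟩ := hcomp.tendsto_subseq (x := x) fun n => by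
    refine ⟨fun s _ => ⟨?_, ?_⟩, mul_nonneg (hεn n).le (hv0 n z).1, (hv0 n z).2⟩
    · have := hvC n z s
      simp only [x]
      linarith
    · have := hvC n s z
      simp only [x]
      linarith
  have hw : ∀ s, Tendsto (fun n => v (φ n) s - v (φ n) z) atTop (nhds (w s)) := fun s =>
    (tendsto_pi_nhds.1 ((continuous_fst.tendsto _).comp hlim)) s
  have hρ : Tendsto (fun n => e (φ n) * v (φ n) z) atTop (nhds ρ) :=
    (continuous_snd.tendsto _).comp hlim
  have heφ := he0.comp hφ.tendsto_atTop
  have hgap : ∀ s a, Tendsto (fun n => actionValue K c L (e (φ n)) (v (φ n)) s a - v (φ n) s)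
      atTop (nhds (c s a + ∑ t, K s a t * w t - w s - ρ * L a)) := fun s a => by
    have h1 : Tendsto (fun n => c s a
        + (1 - e (φ n) * L a) * ∑ t, K s a t * (v (φ n) t - v (φ n) z)
        - (v (φ n) s - v (φ n) z) - e (φ n) * v (φ n) z * L a) atTop
        (nhds (c s a + (1 - 0 * L a) * ∑ t, K s a t * w t - w s - ρ * L a)) :=
      (((((heφ.mul_const (L a)).const_sub 1).mul
        (tendsto_finsetSum _ fun t _ => (hw t).const_mul (K s a t))).const_add (c s a)).sub
        (hw s)).sub (hρ.mul_const (L a))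
    rw [zero_mul, sub_zero, one_mul] at h1
    refine h1.congr fun n => ?_
    have h2 : ∑ t, K s a t * (v (φ n) t - v (φ n) z)
        = ∑ t, K s a t * v (φ n) t - v (φ n) z := by
      simp only [mul_sub, Finset.sum_sub_distrib, (hK s a).sum_mul_const]
    rw [h2, actionValue]
    ring
  refine ⟨ρ, w, fun s a ha => ge_of_tendsto' (hgap s a) fun n => sub_nonneg.2 (hv1 _ s a ha),
    fun s => ?_⟩
  -- The minimising action may change with `n`. The product of the gaps over the admissible actions
  -- is zero for every `n`, hence in the limit, so some limiting gap is zero.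
  have hprod := tendsto_finsetProd (Finset.univ.filter fun a => feas s a) fun a _ => hgap s a
  have hzero : ∀ n, ∏ a ∈ Finset.univ.filter (fun a => feas s a),
      (actionValue K c L (e (φ n)) (v (φ n)) s a - v (φ n) s) = 0 := fun n => by
    obtain ⟨a, ha, h⟩ := hv2 (φ n) s
    exact Finset.prod_eq_zero (by simpa using ha) (sub_eq_zero.2 h.symm)
  simp only [hzero] at hprod
  obtain ⟨a, ha, h⟩ := Finset.prod_eq_zero_iff.1 (tendsto_nhds_unique hprod tendsto_const_nhds)
  exact ⟨a, (Finset.mem_filter.1 ha).2, h⟩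

end Bellman

/-! ## The optimality equation of the Age-of-Inference model -/

namespace AoInfModel

variable {M : AoInfModel}

theorem succProb_nonneg (M : AoInfModel) (a : AoAction) : 0 ≤ M.succProb a := by
  cases a <;> simp [succProb, M.pT_nonneg, M.pO_nonneg]

theorem succProb_le_one (M : AoInfModel) (a : AoAction) : M.succProb a ≤ 1 := by
  cases a <;> simp [succProb, M.pT_le_one, M.pO_le_one]

theorem one_le_dur (M : AoInfModel) (a : AoAction) : (1 : ℝ) ≤ M.dur a := by
  exact_mod_cast M.dur_pos a

theorem sum_kernel_mul (s : M.State) (a : AoAction) (v : M.State → ℝ) :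
    ∑ t, M.kernel s a t * v t
      = (1 - M.succProb a) * v (M.next s a false) + M.succProb a * v (M.next s a true) := by
  simp [kernel, add_mul, Finset.sum_add_distrib]

theorem isDist_kernel (s : M.State) (a : AoAction) : IsDist (M.kernel s a) where
  nonneg t := by
    have h1 := M.succProb_nonneg a
    have h2 := sub_nonneg.2 (M.succProb_le_one a)
    unfold kernel
    split_ifs <;> simp <;> linarith
  sum_one := by simpa using sum_kernel_mul s a fun _ => 1

instance (M : AoInfModel) : Nonempty M.State :=
  ⟨⟨1, 0, false, 0, le_rfl, M.cap_pos, M.period_pos, Nat.zero_le _, fun _ => rfl⟩⟩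

theorem cost_nonneg (s : M.State) (a : AoAction) : 0 ≤ M.cost s a :=
  Finset.sum_nonneg fun _ _ => Nat.cast_nonneg _

theorem cost_le (s : M.State) (a : AoAction) : M.cost s a ≤ M.dur a * M.cap := by
  calc M.cost s a ≤ ∑ _i ∈ Finset.range (M.dur a), (M.cap : ℝ) :=
        Finset.sum_le_sum fun i _ => by exact_mod_cast min_le_right _ _
    _ = _ := by simp

/-- The state `t` is at least as good as `s`, except that ages in `s` which are at least `k` may be
exceeded in `t`. -/
structure Dominates (k : ℕ) (t s : M.State) : Prop where
  phase : t.phase = s.phase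
  cached : s.cached = true → t.cached = true
  age : t.age ≤ s.age ∨ k ≤ s.age
  cacheAge : s.cached = true → t.cacheAge ≤ s.cacheAge ∨ k ≤ s.cacheAge

namespace Dominates

variable {k : ℕ} {t s : M.State}

theorem feasible (h : Dominates k t s) {a : AoAction} (ha : M.Feasible s a) :
    M.Feasible t a := by
  cases a with
  | idle => trivial
  | compute => trivial
  | tx => exact ⟨h.cached ha.1, h.phase ▸ ha.2⟩
  | offload =>
    change M.Uimg ≤ M.remaining t.phase
    exact h.phase ▸ ha

/-- Under the same action an age either restarts from a common value or advances by the duration up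
to the cap, and the threshold advances alike. For a successful tx the new ground age comes from the
cache, and admissibility guarantees that the cache of `s` is filled. -/
theorem next (h : Dominates k t s) {a : AoAction} (ha : M.Feasible s a) (b : Bool) :
    Dominates (min (k + M.dur a) M.cap) (M.next t a b) (M.next s a b) where
  phase := by simp [AoInfModel.next, h.phase]
  cached := by
    have := h.cached
    cases a <;> simp_all [AoInfModel.next, nextCached]
  age := by
    have h1 := h.age
    have h2 := h.cacheAge
    cases a <;> cases b <;> simp only [AoInfModel.next, ageSucc, ageFail] <;>
      simp only [Feasible] at ha <;> grind
  cacheAge := by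
    have h1 := h.cacheAge
    have h2 := h.cached
    cases a <;> simp only [AoInfModel.next, nextCached, nextCacheAge] <;> grind

/-- The potential `cap * (cap - k)` pays for the comparison. While the threshold is below the cap, a
slot costs at most `cap` more and the threshold rises by one; afterwards an age of `s` beyond the
threshold is already at the cap, so `t` is no worse. -/
theorem sum_age_le (h : Dominates k t s) (hk : k ≤ M.cap) (n : ℕ) :
    ∑ i ∈ Finset.range n, min (t.age + i) M.cap + M.cap * k
      ≤ ∑ i ∈ Finset.range n, min (s.age + i) M.cap + M.cap * min (k + n) M.cap := by
  induction n with
  | zero => simp [hk]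
  | succ n ih =>
    rw [Finset.sum_range_succ, Finset.sum_range_succ]
    have h1 := h.age
    by_cases hn : k + n < M.cap
    · have e : min (k + (n + 1)) M.cap = min (k + n) M.cap + 1 := by omega
      rw [e, mul_add]
      have : min (t.age + n) M.cap ≤ M.cap := min_le_right _ _
      omega
    · have e : min (k + (n + 1)) M.cap = min (k + n) M.cap := by omega
      rw [e]
      have : min (t.age + n) M.cap ≤ min (s.age + n) M.cap := by omega
      omega

theorem cost_le (h : Dominates k t s) (hk : k ≤ M.cap) (a : AoAction) :
    M.cost t a + M.cap * k ≤ M.cost s a + M.cap * (min (k + M.dur a) M.cap : ℕ) := by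
  have := h.sum_age_le hk (M.dur a)
  unfold AoInfModel.cost
  exact_mod_cast this

end Dominates

/-! ### Regularity and bounded oscillation of the discounted values -/

theorem next_idle_phase (s : M.State) (b : Bool) :
    (M.next s .idle b).phase = (s.phase + 1) % M.period := rfl

/-- Properties of the discounted value functions that value iteration passes on. -/
structure IsRegularValue (M : AoInfModel) (ε : ℝ) (v : M.State → ℝ) : Prop where
  nonneg : ∀ s, 0 ≤ v s
  le : ∀ s, ε * v s ≤ M.cap
  dominates : ∀ k ≤ M.cap, ∀ t s, Dominates k t s → v t ≤ v s + M.cap * (M.cap - k)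

theorem isClosed_isRegularValue (M : AoInfModel) (ε : ℝ) :
    IsClosed {v | M.IsRegularValue ε v} := by
  have : {v | M.IsRegularValue ε v} = {v : M.State → ℝ | ∀ s, 0 ≤ v s} ∩
      {v | ∀ s, ε * v s ≤ M.cap} ∩
      {v : M.State → ℝ | ∀ k ≤ M.cap, ∀ t s, Dominates k t s → v t ≤ v s + M.cap * (M.cap - k)} := by
    ext v
    exact ⟨fun h => ⟨⟨h.1, h.2⟩, h.3⟩, fun h => ⟨h.1.1, h.1.2, h.2⟩⟩
  rw [this]
  refine (IsClosed.inter ?_ ?_).inter ?_ <;> simp only [Set.ofPred_forall]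
  · exact isClosed_iInter fun s => isClosed_le (by fun_prop) (by fun_prop)
  · exact isClosed_iInter fun s => isClosed_le (by fun_prop) (by fun_prop)
  · exact isClosed_iInter fun k => isClosed_iInter fun _ => isClosed_iInter fun t =>
      isClosed_iInter fun s => isClosed_iInter fun _ => isClosed_le (by fun_prop) (by fun_prop)

theorem isRegularValue_zero (M : AoInfModel) (ε : ℝ) : M.IsRegularValue ε 0 where
  nonneg _ := le_rfl
  le _ := by simp
  dominates k hk t s _ := by
    have : (k : ℝ) ≤ M.cap := by exact_mod_cast hk
    have := mul_nonneg (Nat.cast_nonneg (α := ℝ) M.cap) (sub_nonneg.2 this)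
    simpa using this

/-- For domination, `t` copies a minimising action of `s`, and the potential `cap * (cap - k)`
covers both the extra cost of this action and the later difference. -/
theorem IsRegularValue.step {ε : ℝ} (hε : 0 < ε) (hεL : ∀ a, ε * M.dur a ≤ 1)
    {v w : M.State → ℝ} (hv : M.IsRegularValue ε v)
    (h1 : ∀ s a, M.Feasible s a →
      w s ≤ actionValue M.kernel M.cost (fun a => M.dur a) ε v s a)
    (h2 : ∀ s, ∃ a, M.Feasible s a ∧
      w s = actionValue M.kernel M.cost (fun a => M.dur a) ε v s a) :
    M.IsRegularValue ε w where
  nonneg s := by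
    obtain ⟨a, -, h⟩ := h2 s
    rw [h]
    exact add_nonneg (cost_nonneg s a) (mul_nonneg (sub_nonneg.2 (hεL a))
      ((isDist_kernel s a).le_sum_mul hv.nonneg))
  le s := by
    -- Idling is always admissible and gives `ε * w s ≤ ε * cap + (1 - ε) * cap`.
    have h := h1 s .idle trivial
    have hc := cost_le s .idle
    have hsum : ∑ t, M.kernel s .idle t * (ε * v t) ≤ M.cap := (isDist_kernel s _).sum_mul_le hv.le
    have e : ∑ t, M.kernel s .idle t * (ε * v t) = ε * ∑ t, M.kernel s .idle t * v t := by
      rw [Finset.mul_sum]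
      exact Finset.sum_congr rfl fun t _ => by ring
    have hε1 := hεL .idle
    simp only [actionValue, dur, Nat.cast_one, mul_one, one_mul] at h hc hε1
    rw [e] at hsum
    have h3 := mul_le_mul_of_nonneg_left hsum (sub_nonneg.2 hε1)
    have h4 := mul_le_mul_of_nonneg_left h hε.le
    have h5 := mul_le_mul_of_nonneg_left hc hε.le
    linarith
  dominates k hk t s hts := by
    obtain ⟨a, ha, h⟩ := h2 s
    have ht := h1 t a (hts.feasible ha)
    have hc := hts.cost_le hk a
    set k' := min (k + M.dur a) M.cap with hk'
    have hf := hv.dominates k' (min_le_right _ _) _ _ (hts.next ha false)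
    have htr := hv.dominates k' (min_le_right _ _) _ _ (hts.next ha true)
    rw [h]
    simp only [actionValue, sum_kernel_mul] at ht ⊢
    have hp := M.succProb_nonneg a
    have hp1 := sub_nonneg.2 (M.succProb_le_one a)
    have hd := sub_nonneg.2 (hεL a)
    have hsum := add_le_add (mul_le_mul_of_nonneg_left hf hp1) (mul_le_mul_of_nonneg_left htr hp)
    have hsum' := mul_le_mul_of_nonneg_left hsum hd
    have hkc : (k' : ℝ) ≤ M.cap := by exact_mod_cast min_le_right _ _
    have hpot := mul_nonneg (Nat.cast_nonneg (α := ℝ) M.cap) (sub_nonneg.2 hkc)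
    -- Discounting only shrinks the nonnegative potential left after the action.
    have hdp := mul_nonneg (mul_nonneg hε.le (Nat.cast_nonneg (α := ℝ) (M.dur a))) hpot
    linarith

/-- For an action with a certain outcome; as `v` is nonnegative, omitting the discount factor only
weakens the bound. -/
theorem IsRegularValue.le_of_step {ε : ℝ} (hε : 0 < ε) {v : M.State → ℝ} (hv : M.IsRegularValue ε v)
    (h1 : ∀ s a, M.Feasible s a →
      v s ≤ actionValue M.kernel M.cost (fun a => M.dur a) ε v s a)
    (s : M.State) {a : AoAction} (ha : M.Feasible s a) (hp : M.succProb a = 0) :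
    v s ≤ M.dur a * M.cap + v (M.next s a false) := by
  have h := h1 s a ha
  have hc := cost_le s a
  simp only [actionValue, sum_kernel_mul, hp, sub_zero, one_mul, zero_mul, add_zero] at h
  have h3 := mul_nonneg (mul_nonneg hε.le (Nat.cast_nonneg (α := ℝ) (M.dur a)))
    (hv.nonneg (M.next s a false))
  linarith

/-- Computing takes `CS` slots, idling to the phase of `t` at most `2 * period`, each costing at
most `cap`. Domination at threshold 0 costs a further `cap * cap`. -/
theorem IsRegularValue.oscillation {ε : ℝ} (hε : 0 < ε) {v : M.State → ℝ} (hv : M.IsRegularValue ε v)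
    (h1 : ∀ s a, M.Feasible s a →
      v s ≤ actionValue M.kernel M.cost (fun a => M.dur a) ε v s a) (s t : M.State) :
    v s ≤ v t + (M.CS + 2 * M.period + M.cap) * M.cap := by
  have hidle : ∀ (n : ℕ) (x : M.State), x.cached = true →
      ∃ y : M.State, y.cached = true ∧ y.phase = (x.phase + n) % M.period ∧
        v x ≤ n * M.cap + v y := by
    intro n
    induction n with
    | zero => exact fun x hx => ⟨x, hx, by simp [Nat.mod_eq_of_lt x.phase_lt], by simp⟩
    | succ n ih =>
      intro x hx
      obtain ⟨y, hy, hphase, hle⟩ := ih (M.next x .idle false) hx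
      refine ⟨y, hy, ?_, ?_⟩
      · rw [hphase, next_idle_phase, Nat.mod_add_mod, add_assoc, add_comm 1 n]
      · have h2 := hv.le_of_step hε h1 x (a := .idle) trivial rfl
        simp only [dur, Nat.cast_one] at h2
        push_cast
        linarith
  set x := M.next s .compute false with hx
  -- The additional full period keeps the subtraction of phases from truncating.
  obtain ⟨y, hy, hphase, hle⟩ := hidle (M.period + t.phase - x.phase) x rfl
  have hxp := x.phase_lt
  have htp := t.phase_lt
  -- At threshold 0 nothing is required of the ages; equal phase and a filled cache suffice.
  have hdom : Dominates 0 y t := by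
    refine ⟨?_, fun _ => hy, Or.inr (Nat.zero_le _), fun _ => Or.inr (Nat.zero_le _)⟩
    rw [hphase, Nat.add_sub_cancel' (by omega), Nat.add_mod_left, Nat.mod_eq_of_lt htp]
  have h2 := hv.dominates 0 (Nat.zero_le _) y t hdom
  have h3 := hv.le_of_step hε h1 s (a := .compute) trivial rfl
  have h4 : ((M.period + t.phase - x.phase : ℕ) : ℝ) ≤ 2 * M.period := by
    have : M.period + t.phase - x.phase ≤ 2 * M.period := by omega
    exact_mod_cast this
  have h5 := mul_le_mul_of_nonneg_right h4 (Nat.cast_nonneg (α := ℝ) M.cap)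
  simp only [dur, Nat.cast_zero, sub_zero] at h2 h3
  rw [← hx] at h3
  linarith

/-- Upper bound for the action durations. -/
def maxDur (M : AoInfModel) : ℕ := ∑ a, M.dur a

theorem dur_le_maxDur (M : AoInfModel) (a : AoAction) : M.dur a ≤ M.maxDur :=
  Finset.single_le_sum (f := M.dur) (fun _ _ => Nat.zero_le _) (Finset.mem_univ a)

theorem maxDur_pos (M : AoInfModel) : 0 < M.maxDur :=
  (M.dur_pos .idle).trans_le (M.dur_le_maxDur .idle)

/-- Reduced cost of a state-action pair for the gain `ρ` and the relative values `w`. -/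
noncomputable def reducedCost (M : AoInfModel) (ρ : ℝ) (w : M.State → ℝ) (s : M.State)
    (a : AoAction) : ℝ :=
  M.cost s a + ∑ t, M.kernel s a t * w t - w s - ρ * M.dur a

theorem exists_optimality_equation (M : AoInfModel) :
    ∃ (ρ : ℝ) (w : M.State → ℝ), (∀ s a, M.Feasible s a → 0 ≤ M.reducedCost ρ w s a) ∧
      ∀ s, ∃ a, M.Feasible s a ∧ M.reducedCost ρ w s a = 0 := by
  have hm : (0 : ℝ) < M.maxDur := by exact_mod_cast M.maxDur_pos
  refine exists_average_solution (ε₀ := 1 / M.maxDur) (B := M.cap)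
    (C := (M.CS + 2 * M.period + M.cap) * M.cap) (L := fun a => (M.dur a : ℝ)) (by positivity)
    isDist_kernel fun ε hε hε₀ => ?_
  have hεL : ∀ a, ε * M.dur a ≤ 1 := fun a => by
    have h1 : (M.dur a : ℝ) ≤ M.maxDur := by exact_mod_cast M.dur_le_maxDur a
    rw [le_div_iff₀ hm] at hε₀
    exact (mul_le_mul_of_nonneg_left h1 hε.le).trans hε₀
  obtain ⟨v, hv, h1, h2⟩ := exists_discounted_solution (feas := M.Feasible) (K := M.kernel)
    (c := M.cost) (L := fun a => (M.dur a : ℝ)) (ε := ε) (fun s => ⟨.idle, trivial⟩)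
    isDist_kernel hε M.one_le_dur hεL (M.IsRegularValue ε) (M.isClosed_isRegularValue ε)
    (M.isRegularValue_zero ε) fun v w hv h1 h2 => hv.step hε hεL h1 h2
  exact ⟨v, fun s => ⟨hv.nonneg s, hv.le s⟩, hv.oscillation hε h1, h1, h2⟩

end AoInfModel

/-! ## Long-run averages and reduced costs -/

/-- If, up to a bounded error, `x N` lies between `ρ * N + T k` whenever `k * m ≤ N`, and
`ρ * N + T N`, then the upper long-run average of `x` is at least `ρ`, with equality iff the
long-run average of `T` vanishes. -/
theorem limsup_average_of_sandwich {x T : ℕ → ℝ} {ρ C R : ℝ} {m : ℕ} (hm : 0 < m)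
    (hT0 : ∀ n, 0 ≤ T n) (hT : ∀ n, T n ≤ R * n)
    (hlow : ∀ N k, k * m ≤ N → ρ * N - C + T k ≤ x N) (hup : ∀ N, x N ≤ ρ * N + C + T N) :
    ρ ≤ limsup (fun N : ℕ => 1 / (N : ℝ) * x N) atTop ∧
      (limsup (fun N : ℕ => 1 / (N : ℝ) * x N) atTop ≤ ρ ↔
        Tendsto (fun n : ℕ => T n / n) atTop (nhds 0)) := by
  set y : ℕ → ℝ := fun N => 1 / (N : ℝ) * x N with hy
  have hC : Tendsto (fun N : ℕ => C / (N : ℝ)) atTop (nhds 0) :=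
    tendsto_const_div_atTop_nhds_zero_nat C
  have hylow : ∀ N : ℕ, 0 < N → ∀ k, k * m ≤ N → ρ - C / N + T k / N ≤ y N := by
    intro N hN k hk
    have hN' : (0 : ℝ) < N := by exact_mod_cast hN
    have h := mul_le_mul_of_nonneg_left (hlow N k hk) (one_div_nonneg.2 hN'.le)
    refine le_trans (le_of_eq ?_) h
    field_simp
  have hyup : ∀ N : ℕ, 0 < N → y N ≤ ρ + C / N + T N / N := by
    intro N hN
    have hN' : (0 : ℝ) < N := by exact_mod_cast hN
    have h := mul_le_mul_of_nonneg_left (hup N) (one_div_nonneg.2 hN'.le)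
    refine h.trans (le_of_eq ?_)
    field_simp
  have hlow' : ∀ᶠ N : ℕ in atTop, ρ - C / N ≤ y N := by
    filter_upwards [eventually_gt_atTop 0] with N hN
    have h1 := hylow N hN 0 (by simp)
    have h2 : 0 ≤ T 0 / N := div_nonneg (hT0 0) (Nat.cast_nonneg N)
    linarith
  have hup' : ∀ᶠ N : ℕ in atTop, y N ≤ ρ + C / N + R := by
    filter_upwards [eventually_gt_atTop 0] with N hN
    have hN' : (0 : ℝ) < N := by exact_mod_cast hN
    have h1 := hyup N hN
    have h2 : T N / N ≤ R := (div_le_iff₀ hN').2 (hT N)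
    linarith
  have htlow : Tendsto (fun N : ℕ => ρ - C / (N : ℝ)) atTop (nhds ρ) := by
    simpa using hC.const_sub ρ
  have htup : Tendsto (fun N : ℕ => ρ + C / (N : ℝ) + R) atTop (nhds (ρ + R)) := by
    simpa using (hC.const_add ρ).add_const R
  have hbdd : IsBoundedUnder (· ≤ ·) atTop y := htup.isBoundedUnder_le.mono_le hup'
  have hcob : IsCoboundedUnder (· ≤ ·) atTop y :=
    (htlow.isBoundedUnder_ge.mono_ge hlow').isCoboundedUnder_le
  refine ⟨?_, fun h => ?_, fun h => ?_⟩
  · rw [← htlow.limsup_eq]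
    exact limsup_le_limsup hlow' htlow.isCoboundedUnder_le hbdd
  -- Along `N = k * m` the lower bound contains `T k / (k * m)`. The margin `a / (2 * m)`,
  -- multiplied by `m`, gives `a / 2`, and the error `C / k` is eventually below the other half.
  · refine tendsto_order.2 ⟨fun a ha => Eventually.of_forall fun n =>
      ha.trans_le (div_nonneg (hT0 n) (Nat.cast_nonneg n)), fun a ha => ?_⟩
    have hm' : (0 : ℝ) < m := by exact_mod_cast hm
    have hlt : ∀ᶠ N in atTop, y N < ρ + a / (2 * m) :=
      eventually_lt_of_limsup_lt (h.trans_lt (by linarith [div_pos ha (mul_pos two_pos hm')])) hbdd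
    have hsub : Tendsto (fun k : ℕ => k * m) atTop atTop := tendsto_id.atTop_mul_const' hm
    filter_upwards [hsub.eventually hlt, hC.eventually (gt_mem_nhds (half_pos ha)),
      eventually_gt_atTop 0] with k h1 h2 h3
    have hk : (0 : ℝ) < k := by exact_mod_cast h3
    have h4 := (hylow (k * m) (Nat.mul_pos h3 hm) k le_rfl).trans_lt h1
    have h5 : T k / ((k * m : ℕ) : ℝ) < a / (2 * m) + C / ((k * m : ℕ) : ℝ) := by linarith
    have h6 := mul_lt_mul_of_pos_left h5 hm'
    have e1 : (m : ℝ) * (T k / ((k * m : ℕ) : ℝ)) = T k / k := by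
      push_cast
      field_simp
    have e2 : (m : ℝ) * (a / (2 * m) + C / ((k * m : ℕ) : ℝ)) = a / 2 + C / k := by
      push_cast
      field_simp
    rw [e1, e2] at h6
    linarith
  · have ht : Tendsto (fun N : ℕ => ρ + C / (N : ℝ) + T N / N) atTop (nhds ρ) := by
      simpa using (hC.const_add ρ).add h
    rw [← ht.limsup_eq]
    refine limsup_le_limsup ?_ hcob ht.isBoundedUnder_le
    filter_upwards [eventually_gt_atTop 0] with N hN using hyup N hN

/-! ### Elementary bounds for expected totals -/

section Expect

variable {S A : Type} [Fintype S] [Fintype A] {feas : S → A → Prop} {K : S → A → S → ℝ}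
  {π : Policy feas}

theorem histExpect_const (hK : ∀ s a, IsDist (K s a)) (h : List (S × A)) {μ : S → ℝ}
    (hμ : IsDist μ) (n : ℕ) (r : ℝ) : histExpect K π h μ n (fun _ => r) = r := by
  induction n generalizing h μ with
  | zero => rfl
  | succ n ih => simp only [histExpect, ih _ (hK _ _), sum_policy_mul_const, hμ.sum_mul_const]

theorem totalExpect_le (hK : ∀ s a, IsDist (K s a)) {g : S → A → ℝ} {R : ℝ}
    (hg : ∀ s a, g s a ≤ R) (h : List (S × A)) {μ : S → ℝ} (hμ : IsDist μ) (n : ℕ) :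
    totalExpect K π g h μ n ≤ R * n := by
  induction n generalizing h μ with
  | zero => simp [totalExpect]
  | succ n ih =>
    refine hμ.sum_mul_le fun s => ?_
    rw [← sum_policy_mul_const (π := π) h s (R * _)]
    refine sum_policy_le fun a _ => ?_
    have h1 := hg s a
    have h2 := ih (h ++ [(s, a)]) (hK s a)
    push_cast
    linarith

theorem totalExpect_mono (hK : ∀ s a, IsDist (K s a)) {g : S → A → ℝ}
    (hg : ∀ s a, feas s a → 0 ≤ g s a) (h : List (S × A)) {μ : S → ℝ} (hμ : IsDist μ) {n m : ℕ}
    (hnm : n ≤ m) : totalExpect K π g h μ n ≤ totalExpect K π g h μ m := by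
  induction n generalizing h μ m with
  | zero => exact totalExpect_nonneg hK hg h hμ m
  | succ n ih =>
    obtain ⟨m, rfl⟩ := Nat.exists_eq_succ_of_ne_zero (show m ≠ 0 by omega)
    refine Finset.sum_le_sum fun s _ => mul_le_mul_of_nonneg_left ?_ (hμ.nonneg s)
    exact sum_policy_le fun a _ => add_le_add le_rfl (ih _ (hK s a) (by omega))

theorem sum_policy_add_add {μ : S → ℝ} (hμ : IsDist μ) (h : List (S × A)) (r : ℝ) (w : S → ℝ)
    (g : S → A → ℝ) :
    ∑ s, μ s * ∑ a, π.prob h s a * (r + w s + g s a)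
      = r + ∑ s, μ s * w s + ∑ s, μ s * ∑ a, π.prob h s a * g s a := by
  simp only [mul_add (π.prob _ _ _) (_ + _), Finset.sum_add_distrib, sum_policy_mul_const]
  simp only [mul_add, Finset.sum_add_distrib, hμ.sum_mul_const]

theorem sum_point_mul (s : S) (f : S → ℝ) : ∑ t, (if t = s then (1 : ℝ) else 0) * f t = f s := by
  simp

end Expect

/-! ### From slots to decision epochs -/

namespace AoInfModel

variable {M : AoInfModel}

/-- Total age over the first `N` slots along a sequence of pairs (state, action). -/
noncomputable def slotSum (M : AoInfModel) (N : ℕ) (l : List (M.State × AoAction)) : ℝ :=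
  ∑ n ∈ Finset.range N, (M.slotAge l n : ℝ)

theorem slotSum_cons_of_le {N : ℕ} {s : M.State} {a : AoAction} (h : M.dur a ≤ N)
    (l : List (M.State × AoAction)) :
    M.slotSum N ((s, a) :: l) = M.cost s a + M.slotSum (N - M.dur a) l := by
  obtain ⟨k, rfl⟩ := Nat.exists_eq_add_of_le h
  rw [slotSum, Finset.sum_range_add, Nat.add_sub_cancel_left, cost, slotSum]
  congr 1
  · refine Finset.sum_congr rfl fun i hi => ?_
    rw [slotAge, if_pos (Finset.mem_range.1 hi)]
  · refine Finset.sum_congr rfl fun i _ => ?_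
    rw [slotAge, if_neg (by omega), Nat.add_sub_cancel_left]

theorem slotSum_cons_of_lt {N : ℕ} {s : M.State} {a : AoAction} (h : N < M.dur a)
    (l : List (M.State × AoAction)) :
    M.slotSum N ((s, a) :: l) = ∑ n ∈ Finset.range N, ((min (s.age + n) M.cap : ℕ) : ℝ) := by
  refine Finset.sum_congr rfl fun i hi => ?_
  rw [slotAge, if_pos ((Finset.mem_range.1 hi).trans h)]

theorem sum_age_le (N : ℕ) (s : M.State) :
    ∑ n ∈ Finset.range N, ((min (s.age + n) M.cap : ℕ) : ℝ) ≤ N * M.cap := by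
  calc _ ≤ ∑ _i ∈ Finset.range N, (M.cap : ℝ) :=
        Finset.sum_le_sum fun i _ => by exact_mod_cast min_le_right _ _
    _ = _ := by simp

section Bounds

variable {ρ : ℝ} {w : M.State → ℝ} {π : Policy M.Feasible} {B : ℝ}

theorem abs_mul_le_of_lt {N : ℕ} {a : AoAction} (h : N < M.dur a) :
    |ρ * N| ≤ |ρ| * M.maxDur := by
  rw [abs_mul, Nat.abs_cast]
  have : (N : ℝ) ≤ M.maxDur := by exact_mod_cast h.le.trans (M.dur_le_maxDur a)
  exact mul_le_mul_of_nonneg_left this (abs_nonneg ρ)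

/-- Removing the first action replaces its cost by `ρ` times its duration, a telescoping difference
of `w` and its reduced cost. If `k * maxDur ≤ N`, the first `k` actions fit into the horizon; only
an action cut off by the horizon produces an error. -/
theorem le_histExpect_slotSum (hred : ∀ s a, M.Feasible s a → 0 ≤ M.reducedCost ρ w s a)
    (hB : ∀ s, |w s| ≤ B) (h : List (M.State × AoAction)) {μ : M.State → ℝ} (hμ : IsDist μ)
    (n N k : ℕ) (hN : N ≤ n) (hk : k * M.maxDur ≤ N) :
    ρ * N - (B + |ρ| * M.maxDur) + ∑ s, μ s * w s
        + totalExpect M.kernel π (M.reducedCost ρ w) h μ k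
      ≤ histExpect M.kernel π h μ n (M.slotSum N) := by
  have hpos : 0 ≤ |ρ| * M.maxDur := by positivity
  induction n generalizing h μ N k with
  | zero =>
    obtain rfl : N = 0 := by omega
    obtain rfl : k = 0 := by
      have := M.maxDur_pos
      rcases Nat.eq_zero_or_pos k with e | e
      · exact e
      · exact absurd (Nat.mul_pos e this) (by omega)
    have h1 := hμ.sum_mul_le fun s => (abs_le.1 (hB s)).2
    simp only [histExpect, slotSum, totalExpect, Finset.range_zero, Finset.sum_empty,
      Nat.cast_zero, mul_zero]
    linarith
  | succ n ih =>
    have hlong : ∀ s a, M.dur a ≤ N → ∀ k, k * M.maxDur ≤ N - M.dur a →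
        ρ * N - (B + |ρ| * M.maxDur) + w s + (M.reducedCost ρ w s a
          + totalExpect M.kernel π (M.reducedCost ρ w) (h ++ [(s, a)]) (M.kernel s a) k)
        ≤ histExpect M.kernel π (h ++ [(s, a)]) (M.kernel s a) n
            (fun l => M.slotSum N ((s, a) :: l)) := by
      intro s a ha k hk
      have h0 := M.dur_pos a
      have h1 := ih (h ++ [(s, a)]) (isDist_kernel s a) (N - M.dur a) k (by omega) hk
      simp only [slotSum_cons_of_le ha]
      rw [histExpect_const_add isDist_kernel _ (isDist_kernel s a)]
      rw [Nat.cast_sub ha] at h1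
      simp only [reducedCost] at h1 ⊢
      linarith
    -- For `k = 0` the reduced costs are nonnegative and are dropped, and the action may be cut off
    -- by the horizon. For `k + 1` the first action certainly fits.
    rcases k with _ | k
    · have e := sum_policy_add_add (π := π) hμ h (ρ * N - (B + |ρ| * M.maxDur)) w fun _ _ => 0
      simp only [mul_zero, Finset.sum_const_zero] at e
      rw [totalExpect, ← e, histExpect]
      refine Finset.sum_le_sum fun s _ => mul_le_mul_of_nonneg_left ?_ (hμ.nonneg s)
      refine sum_policy_le fun a ha => ?_
      by_cases hd : M.dur a ≤ N
      · have h1 := hlong s a hd 0 (by simp)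
        have h2 := hred s a ha
        simp only [totalExpect] at h1
        linarith
      · push Not at hd
        simp only [slotSum_cons_of_lt hd]
        rw [histExpect_const isDist_kernel _ (isDist_kernel s a)]
        have h1 := (abs_le.1 (abs_mul_le_of_lt (ρ := ρ) hd)).2
        have h2 := (abs_le.1 (hB s)).2
        have h3 : 0 ≤ ∑ n ∈ Finset.range N, ((min (s.age + n) M.cap : ℕ) : ℝ) :=
          Finset.sum_nonneg fun _ _ => Nat.cast_nonneg _
        linarith
    · rw [totalExpect, ← sum_policy_add_add hμ, histExpect]
      refine Finset.sum_le_sum fun s _ => mul_le_mul_of_nonneg_left ?_ (hμ.nonneg s)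
      refine sum_policy_le fun a ha => ?_
      have hd := M.dur_le_maxDur a
      rw [add_mul, one_mul] at hk
      exact hlong s a (by omega) k (by omega)

/-- Since each action takes at least one slot, no more than `n` actions start within `N ≤ n` slots;
reduced costs of later epochs are nonnegative and may be added. A cut-off action accounts for the
extra `maxDur * cap`. -/
theorem histExpect_slotSum_le (hred : ∀ s a, M.Feasible s a → 0 ≤ M.reducedCost ρ w s a)
    (hB : ∀ s, |w s| ≤ B) (h : List (M.State × AoAction)) {μ : M.State → ℝ} (hμ : IsDist μ)
    (n N : ℕ) (hN : N ≤ n) :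
    histExpect M.kernel π h μ n (M.slotSum N)
      ≤ ρ * N + (B + |ρ| * M.maxDur + M.maxDur * M.cap) + ∑ s, μ s * w s
        + totalExpect M.kernel π (M.reducedCost ρ w) h μ n := by
  have hpos : 0 ≤ |ρ| * M.maxDur := by positivity
  have hpos' : (0 : ℝ) ≤ M.maxDur * M.cap := by positivity
  induction n generalizing h μ N with
  | zero =>
    obtain rfl : N = 0 := by omega
    have h1 := hμ.le_sum_mul fun s => (abs_le.1 (hB s)).1
    simp only [histExpect, slotSum, totalExpect, Finset.range_zero, Finset.sum_empty,
      Nat.cast_zero, mul_zero]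
    linarith
  | succ n ih =>
    rw [totalExpect, ← sum_policy_add_add hμ, histExpect]
    refine Finset.sum_le_sum fun s _ => mul_le_mul_of_nonneg_left ?_ (hμ.nonneg s)
    refine sum_policy_le fun a ha => ?_
    by_cases hd : M.dur a ≤ N
    · have h0 := M.dur_pos a
      have h1 := ih (h ++ [(s, a)]) (isDist_kernel s a) (N - M.dur a) (by omega)
      simp only [slotSum_cons_of_le hd]
      rw [histExpect_const_add isDist_kernel _ (isDist_kernel s a)]
      rw [Nat.cast_sub hd] at h1
      simp only [reducedCost] at h1 ⊢
      linarith
    · push Not at hd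
      simp only [slotSum_cons_of_lt hd]
      rw [histExpect_const isDist_kernel _ (isDist_kernel s a)]
      have h1 := (abs_le.1 (abs_mul_le_of_lt (ρ := ρ) hd)).1
      have h2 := (abs_le.1 (hB s)).1
      have h3 := sum_age_le N s
      have h4 : (N : ℝ) * M.cap ≤ M.maxDur * M.cap := by
        exact_mod_cast Nat.mul_le_mul_right _ (hd.le.trans (M.dur_le_maxDur a))
      have h5 := hred s a ha
      have h6 := totalExpect_nonneg (π := π) isDist_kernel hred (h ++ [(s, a)])
        (isDist_kernel s a) n
      linarith

end Bounds

/-! ## The transformed chain -/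

theorem mdpKernel_eq (θ : ℝ) (s : M.State) (a : AoAction) (t : M.State) :
    M.mdpKernel θ s a t
      = θ / M.dur a * M.kernel s a t + (1 - θ / M.dur a) * (if t = s then 1 else 0) := by
  unfold mdpKernel
  by_cases h : t = s
  · subst h
    simp
    ring
  · simp [h]

section Transformed

variable {θ : ℝ}

theorem div_dur_le_one (hθL : ∀ a : AoAction, θ ≤ (M.dur a : ℝ)) (a : AoAction) :
    θ / M.dur a ≤ 1 :=
  div_le_one_of_le₀ (hθL a) (Nat.cast_nonneg _)

theorem div_dur_pos (hθ : 0 < θ) (a : AoAction) : 0 < θ / M.dur a :=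
  div_pos hθ (Nat.cast_pos.2 (M.dur_pos a))

theorem sum_mdpKernel_mul (s : M.State) (a : AoAction) (v : M.State → ℝ) :
    ∑ t, M.mdpKernel θ s a t * v t
      = θ / M.dur a * ∑ t, M.kernel s a t * v t + (1 - θ / M.dur a) * v s := by
  simp only [mdpKernel_eq, add_mul, Finset.sum_add_distrib, mul_assoc, ← Finset.mul_sum,
    sum_point_mul]

theorem isDist_mdpKernel (hθ : 0 < θ) (hθL : ∀ a : AoAction, θ ≤ (M.dur a : ℝ)) (s : M.State)
    (a : AoAction) : IsDist (M.mdpKernel θ s a) where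
  nonneg t := by
    rw [mdpKernel_eq]
    have h1 := mul_nonneg (div_dur_pos (M := M) hθ a).le ((isDist_kernel s a).nonneg t)
    have h2 := sub_nonneg.2 (div_dur_le_one hθL a)
    split_ifs <;> simp only [mul_one, mul_zero] <;> linarith
  sum_one := by
    have h := sum_mdpKernel_mul (θ := θ) s a fun _ => 1
    simp only [mul_one, (isDist_kernel s a).sum_one] at h
    rw [h]
    ring

/-- The transformed chain makes the original move with probability `θ / L_a` and otherwise stays, so
the mean increment of `w` is scaled by `θ / L_a`. The cost is scaled alike, and `ρ * L_a` becomes `θ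
* ρ`. -/
theorem reducedCost_mdp (ρ : ℝ) (w : M.State → ℝ) (s : M.State) (a : AoAction) :
    M.mdpCost θ s a + ∑ t, M.mdpKernel θ s a t * w t - w s - θ * ρ
      = θ / M.dur a * M.reducedCost ρ w s a := by
  have : (M.dur a : ℝ) ≠ 0 := Nat.cast_ne_zero.2 (M.dur_pos a).ne'
  rw [sum_mdpKernel_mul, mdpCost, reducedCost]
  field_simp
  ring

end Transformed

/-! ## Gain of stationary policies -/

section Gain

variable {ρ : ℝ} {w : M.State → ℝ} {θ : ℝ}

theorem exists_abs_le (w : M.State → ℝ) : ∃ B, ∀ s, |w s| ≤ B := by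
  obtain ⟨B, hB⟩ := (Set.finite_range fun s => |w s|).bddAbove
  exact ⟨B, fun s => hB ⟨s, rfl⟩⟩

theorem exists_le (g : M.State → AoAction → ℝ) : ∃ R, ∀ s a, g s a ≤ R := by
  obtain ⟨R, hR⟩ := (Set.finite_range fun x : M.State × AoAction => g x.1 x.2).bddAbove
  exact ⟨R, fun s a => hR ⟨(s, a), rfl⟩⟩

theorem smdpAvg_spec (hred : ∀ s a, M.Feasible s a → 0 ≤ M.reducedCost ρ w s a)
    (π : Policy M.Feasible) (s : M.State) :
    ρ ≤ M.smdpAvg π s ∧ (M.smdpAvg π s ≤ ρ ↔ Tendsto (fun n : ℕ =>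
      totalExpect M.kernel π (M.reducedCost ρ w) [] (fun t => if t = s then 1 else 0) n / n)
      atTop (nhds 0)) := by
  obtain ⟨B, hB⟩ := exists_abs_le w
  obtain ⟨R, hR⟩ := exists_le (M.reducedCost ρ w)
  have hs := abs_le.1 (hB s)
  have hpos : (0 : ℝ) ≤ M.maxDur * M.cap := by positivity
  refine limsup_average_of_sandwich (R := R)
    (C := B + (B + |ρ| * M.maxDur + M.maxDur * M.cap)) M.maxDur_pos
    (totalExpect_nonneg isDist_kernel hred _ (isDist_point s))
    (totalExpect_le isDist_kernel hR _ (isDist_point s)) (fun N k hk => ?_) (fun N => ?_)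
  · have h := le_histExpect_slotSum (π := π) hred hB [] (isDist_point s) N N k le_rfl hk
    rw [sum_point_mul] at h
    rw [pathExpect_eq_histExpect]
    unfold slotSum at h
    linarith
  · have h := histExpect_slotSum_le (π := π) hred hB [] (isDist_point s) N N le_rfl
    rw [sum_point_mul] at h
    rw [pathExpect_eq_histExpect]
    unfold slotSum at h
    linarith

theorem mdpAvg_spec (hθ : 0 < θ) (hθL : ∀ a : AoAction, θ ≤ (M.dur a : ℝ))
    (hred : ∀ s a, M.Feasible s a → 0 ≤ M.reducedCost ρ w s a)
    (π : Policy M.Feasible) (s : M.State) :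
    θ * ρ ≤ M.mdpAvg θ π s ∧ (M.mdpAvg θ π s ≤ θ * ρ ↔ Tendsto (fun n : ℕ =>
      totalExpect (M.mdpKernel θ) π (fun s a => θ / M.dur a * M.reducedCost ρ w s a) []
        (fun t => if t = s then 1 else 0) n / n) atTop (nhds 0)) := by
  set g : M.State → AoAction → ℝ := fun s a => θ / M.dur a * M.reducedCost ρ w s a with hg
  have hg0 : ∀ s a, M.Feasible s a → 0 ≤ g s a := fun s a ha =>
    mul_nonneg (div_dur_pos hθ a).le (hred s a ha)
  have hK := isDist_mdpKernel hθ hθL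
  obtain ⟨B, hB⟩ := exists_abs_le w
  obtain ⟨R, hR⟩ := exists_le g
  have hs := abs_le.1 (hB s)
  have hmono : ∀ {n m : ℕ}, n ≤ m →
      totalExpect (M.mdpKernel θ) π g [] (fun t => if t = s then 1 else 0) n
        ≤ totalExpect (M.mdpKernel θ) π g [] (fun t => if t = s then 1 else 0) m :=
    fun h => totalExpect_mono hK hg0 _ (isDist_point s) h
  have hbound : ∀ N, |totalExpect (M.mdpKernel θ) π (M.mdpCost θ) []
      (fun t => if t = s then 1 else 0) N - (θ * ρ * N + w s
        + totalExpect (M.mdpKernel θ) π g [] (fun t => if t = s then 1 else 0) N)| ≤ B := by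
    intro N
    have h := abs_totalExpect_sub_le (π := π) (c := M.mdpCost θ) (ρ := θ * ρ) hK hB []
      (isDist_point s) N
    simp only [reducedCost_mdp] at h
    rwa [sum_point_mul] at h
  refine limsup_average_of_sandwich (R := R) (C := B + B) Nat.one_pos
    (totalExpect_nonneg hK hg0 _ (isDist_point s))
    (totalExpect_le hK hR _ (isDist_point s)) (fun N k hk => ?_) (fun N => ?_)
  · rw [pathExpect_eq_histExpect, histExpect_sum_eq_totalExpect hK]
    have h1 := (abs_le.1 (hbound N)).1
    have h2 := hmono (show k ≤ N by omega)
    linarith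
  · rw [pathExpect_eq_histExpect, histExpect_sum_eq_totalExpect hK]
    have h1 := (abs_le.1 (hbound N)).2
    linarith

/-- Both sides reduce to the graph criterion for vanishing averages. Self-loops are irrelevant to
reachability, and the positive factors `θ / L_a` preserve the other edges and the zeros of the mean
reduced cost. -/
theorem smdpAvg_le_iff_mdpAvg_le (hθ : 0 < θ) (hθL : ∀ a : AoAction, θ ≤ (M.dur a : ℝ))
    (hred : ∀ s a, M.Feasible s a → 0 ≤ M.reducedCost ρ w s a)
    (σ : StationaryPolicy M.Feasible) (s : M.State) :
    M.smdpAvg σ.toPolicy s ≤ ρ ↔ M.mdpAvg θ σ.toPolicy s ≤ θ * ρ := by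
  have hK := isDist_mdpKernel hθ hθL
  have hg0 : ∀ s a, M.Feasible s a → 0 ≤ θ / M.dur a * M.reducedCost ρ w s a := fun s a ha =>
    mul_nonneg (div_dur_pos hθ a).le (hred s a ha)
  rw [(smdpAvg_spec hred _ s).2, (mdpAvg_spec hθ hθL hred _ s).2]
  simp only [StationaryPolicy.totalExpect_eq_chainSum, sum_point_mul]
  rw [(σ.isStochastic_matrix isDist_kernel).tendsto_chainSum_div_iff (σ.mean_nonneg hred),
    (σ.isStochastic_matrix hK).tendsto_chainSum_div_iff (σ.mean_nonneg hg0)]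
  have hreach : ∀ s t, Reach (σ.matrix M.kernel) s t ↔ Reach (σ.matrix (M.mdpKernel θ)) s t := by
    refine reach_iff_of_offDiag fun s t hst => ?_
    rw [σ.matrix_pos_iff fun a => (isDist_kernel s a).nonneg t,
      σ.matrix_pos_iff fun a => (hK s a).nonneg t]
    refine exists_congr fun a => and_congr_right fun _ => ?_
    rw [mdpKernel_eq, if_neg hst.symm, mul_zero, add_zero, mul_pos_iff_of_pos_left (div_dur_pos hθ a)]
  have hmean : ∀ t, σ.mean (M.reducedCost ρ w) t = 0 ↔
      σ.mean (fun s a => θ / M.dur a * M.reducedCost ρ w s a) t = 0 := fun t => by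
    rw [σ.mean_eq_zero_iff hred, σ.mean_eq_zero_iff hg0]
    simp only [mul_eq_zero, (div_dur_pos hθ _).ne', false_or]
  simp only [hreach, hmean]

/-- The deterministic stationary policy that takes the action `f s` in state `s`. -/
noncomputable def deterministicPolicy (f : M.State → AoAction) (hf : ∀ s, M.Feasible s (f s)) :
    StationaryPolicy M.Feasible where
  prob s a := if a = f s then 1 else 0
  nonneg s a := by split_ifs <;> norm_num
  sum_one s := by simp
  support s a ha := if_neg fun e : a = f s => ha (e ▸ hf s)

theorem exists_stationary_smdpAvg_le (hred : ∀ s a, M.Feasible s a → 0 ≤ M.reducedCost ρ w s a)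
    (hzero : ∀ s, ∃ a, M.Feasible s a ∧ M.reducedCost ρ w s a = 0) :
    ∃ σ : StationaryPolicy M.Feasible, ∀ s, M.smdpAvg σ.toPolicy s ≤ ρ := by
  choose f hf hf0 using hzero
  refine ⟨deterministicPolicy f hf, fun s => ?_⟩
  rw [(smdpAvg_spec hred _ s).2]
  simp only [StationaryPolicy.totalExpect_eq_chainSum, sum_point_mul]
  rw [((deterministicPolicy f hf).isStochastic_matrix isDist_kernel).tendsto_chainSum_div_iff
    ((deterministicPolicy f hf).mean_nonneg hred)]
  -- The chosen actions have zero reduced cost everywhere, so each state is its own witness.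
  refine fun t _ => ⟨t, Relation.ReflTransGen.refl, fun u _ => ?_⟩
  simp [StationaryPolicy.mean, deterministicPolicy, hf0]

end Gain

end AoInfModel

/-- Optimality of stationary policies agrees from each initial state (hence also from all initial
states at once), and the optimal values, which do not depend on the initial state, are `ρ`
and `θ * ρ`. -/
theorem mainTheorem1 (M : AoInfModel) (θ : ℝ) (hθ : 0 < θ)
    (hθL : ∀ a : AoAction, θ ≤ (M.dur a : ℝ)) :
    (∀ s : M.State,
      {σ : StationaryPolicy M.Feasible | M.SmdpOptimalFrom s σ}
        = {σ : StationaryPolicy M.Feasible | M.MdpOptimalFrom θ s σ}) ∧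
    ∃ ρ : ℝ,
      (∀ s : M.State, IsLeast (Set.range (fun π : Policy M.Feasible => M.smdpAvg π s)) ρ) ∧
      (∀ s : M.State, IsLeast (Set.range (fun π : Policy M.Feasible => M.mdpAvg θ π s)) (θ * ρ)) := by
  obtain ⟨ρ, w, hred, hzero⟩ := M.exists_optimality_equation
  obtain ⟨σ₀, hσ₀⟩ := AoInfModel.exists_stationary_smdpAvg_le hred hzero
  have hlow := fun π s => (AoInfModel.smdpAvg_spec hred π s).1
  have hlow' := fun π s => (AoInfModel.mdpAvg_spec hθ hθL hred π s).1
  have hiff := AoInfModel.smdpAvg_le_iff_mdpAvg_le hθ hθL hred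
  have hσ₀' := fun s => (hiff σ₀ s).1 (hσ₀ s)
  refine ⟨fun s => Set.ext fun σ => ?_, ρ, fun s => ⟨⟨σ₀.toPolicy, ?_⟩, ?_⟩,
    fun s => ⟨⟨σ₀.toPolicy, ?_⟩, ?_⟩⟩
  -- As `σ₀` attains both lower bounds, optimality from `s` amounts to not exceeding them.
  · have h1 : M.SmdpOptimalFrom s σ ↔ M.smdpAvg σ.toPolicy s ≤ ρ :=
      ⟨fun h => (h _).trans (hσ₀ s), fun h π => h.trans (hlow π s)⟩
    have h2 : M.MdpOptimalFrom θ s σ ↔ M.mdpAvg θ σ.toPolicy s ≤ θ * ρ :=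
      ⟨fun h => (h _).trans (hσ₀' s), fun h π => h.trans (hlow' π s)⟩
    exact h1.trans ((hiff σ s).trans h2.symm)
  · exact le_antisymm (hσ₀ s) (hlow _ s)
  · rintro _ ⟨π, rfl⟩
    exact hlow π s
  · exact le_antisymm (hσ₀' s) (hlow' _ s)
  · rintro _ ⟨π, rfl⟩
    exact hlow' π s
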